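/- Let the Pascal graph be graded by the nonpositive integers: at level $n\le 0$ its vertices are $0,1,\dots,|n|$, and each vertex $v$ at level $n$ is connected by a single edge to each of the vertices $v$ and $v+1$ at level $n-1$. Its infinite paths starting at the root (the only vertex at level $0$) are coded by sequences of bits indexed by the nonpositive integers, the bit telling at each level whether the path goes from $v$ to $v$ (bit $0$) or to $v+1$ (bit $1$). Let $p\in[0,1]$ and let $\mu$ be the infinite product Bernoulli measure $(p,1-p)$ on the path space, under which the bits are independent, each being $1$ with probability $p$ and $0$ with probability $1-p$. For $n\le 0$ let $V_n$ be the vertex at level $n$ of the random path. Then, under $\mu$: 1. $(V_n)_{n\le 0}$ is a monotonic Markov process: there are Markov kernels $P_n$ ($n\le 0$) from $\{0,\dots,|n-1|\}$ to $\{0,\dots,|n|\}$ such that $\mathbb P(V_n\in B\mid V_{n-1},V_{n-2},\dots)=P_n(V_{n-1},B)$ almost surely for every $n\le 0$ and every $B$, and such that, for all $x\le x'$, the measure $P_n(x,\cdot)$ is stochastically dominated by $P_n(x',\cdot)$ (there is a coupling $(Y,Y')$ of these two laws with $Y\le Y'$ almost surely). 2. The filtration $\mathcal F=(\mathcal F_n)_{n\le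 0}$, $\mathcal F_n=\sigma(V_m;\, m\le n)$, is standard: there are, on some probability space, a filtration $\mathcal F'$ isomorphic to $\mathcal F$ (that is, $\mathcal F$ and $\mathcal F'$ are generated by two processes with values in standard Borel spaces having the same law) and a filtration $\mathcal G'$ on that space generated by a sequence of independent random variables $(U_n)_{n\le 0}$, such that $\mathcal F'$ is immersed in $\mathcal G'$, that is, $\mathcal F'_n\subset\mathcal G'_n$ for all $n\le 0$ and, for every $n<0$, $\mathcal F'_{n+1}$ is conditionally independent of $\mathcal G'_n$ given $\mathcal F'_n$. 3. In particular $\mu$ is ergodic: if $\mathcal G_n$ denotes the $\sigma$-field generated by the edges of the random path connecting levels $m-1$ and $m$, for all $m\le n$, then every event of the tail $\sigma$-field $\bigcap_{n\le 0}\mathcal G_n$ has probability $0$ or $1$. -/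

import Mathlib

open MeasureTheory ProbabilityTheory OrderDual

/-! Time runs through the nonpositive integers. Time `-n` is represented by the natural number `n`
when it indexes a process, and by `toDual n : ℕᵒᵈ` when it indexes a filtration, so that the order
of `ℕᵒᵈ` is the order of time and filtrations are increasing in the usual sense. -/

section Filtrations

variable {Ω : Type*} [mΩ : MeasurableSpace Ω]

/-- The filtration generated by a process `(X n)`, where `X n` is the value at time `-n`: the
σ-field at time `-n` is generated by the values at all times `-j ≤ -n`. -/
def pastFiltration {E : ℕ → Type*} [∀ n, MeasurableSpace (E n)] (X : ∀ n, Ω → E n)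
    (hX : ∀ n, Measurable (X n)) : Filtration ℕᵒᵈ mΩ where
  seq k := ⨆ j : ℕ, ⨆ _ : ofDual k ≤ j, MeasurableSpace.comap (X j) inferInstance
  mono' := fun _ _ hkl =>
    iSup_mono fun _ => iSup_mono' fun hj => ⟨le_trans (ofDual_le_ofDual.mpr hkl) hj, le_rfl⟩
  le' := fun _ => iSup_le fun j => iSup_le fun _ => (hX j).comap_le

/-- `F` is immersed in `G`: `F ⊆ G`, and for every time `-(n+1) < 0` the σ-field of `F` at the next
time `-n` is conditionally independent of `G` at time `-(n+1)` given `F` at time `-(n+1)`. -/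
def Immersed [StandardBorelSpace Ω] (P : Measure Ω) [IsFiniteMeasure P]
    (F G : Filtration ℕᵒᵈ mΩ) : Prop :=
  F ≤ G ∧ ∀ n : ℕ, CondIndep (F (toDual (n + 1))) (F (toDual n)) (G (toDual (n + 1)))
    (F.le (toDual (n + 1))) P

/-- A filtration is of product type when it is generated by a sequence of independent random
variables. -/
def IsProductType (P : Measure Ω) (G : Filtration ℕᵒᵈ mΩ) : Prop :=
  ∃ (E : ℕ → Type) (_ : ∀ n, MeasurableSpace (E n)) (U : ∀ n, Ω → E n)
    (hU : ∀ n, Measurable (U n)), iIndepFun U P ∧ G = pastFiltration U hU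

/-- Two filtrations, on possibly different probability spaces, are isomorphic when they are
generated by two processes with the same law (each one is a copy of the other), with values in
standard Borel spaces. -/
def IsomorphicFiltrations {Ω' : Type*} [mΩ' : MeasurableSpace Ω']
    (P : Measure Ω) (F : Filtration ℕᵒᵈ mΩ) (P' : Measure Ω') (F' : Filtration ℕᵒᵈ mΩ') : Prop :=
  ∃ (E : ℕ → Type) (_ : ∀ n, MeasurableSpace (E n)) (_ : ∀ n, StandardBorelSpace (E n))
    (X : ∀ n, Ω → E n) (hX : ∀ n, Measurable (X n))
    (X' : ∀ n, Ω' → E n) (hX' : ∀ n, Measurable (X' n)),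
    F = pastFiltration X hX ∧ F' = pastFiltration X' hX' ∧
      P.map (fun ω n => X n ω) = P'.map (fun ω n => X' n ω)

/-- A filtration is standard when, up to isomorphism, it is immersed in a filtration of product
type. -/
def IsStandardFiltration (P : Measure Ω) (F : Filtration ℕᵒᵈ mΩ) : Prop :=
  ∃ (Ω' : Type) (mΩ' : MeasurableSpace Ω') (_ : StandardBorelSpace Ω') (P' : Measure Ω')
    (_ : IsProbabilityMeasure P') (F' G : Filtration ℕᵒᵈ mΩ'),
    IsomorphicFiltrations P F P' F' ∧ IsProductType P' G ∧ Immersed P' F' G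

/-- A filtration is Kolmogorovian when its tail σ-field (the intersection of its σ-fields over all
times) is degenerate. -/
def IsKolmogorovian (P : Measure Ω) (F : Filtration ℕᵒᵈ mΩ) : Prop :=
  ∀ s : Set Ω, MeasurableSet[⨅ k, F k] s → P s = 0 ∨ P s = 1

end Filtrations

section MonotonicMarkov

/-- `μ` is stochastically dominated by `ν`: some coupling `π` of `μ` and `ν` is carried by the set
of pairs `(x, y)` with `x ≤ y`. -/
def StochDominated {A : Type*} [MeasurableSpace A] [Preorder A] (μ ν : Measure A) : Prop :=
  ∃ π : Measure (A × A), π.map Prod.fst = μ ∧ π.map Prod.snd = ν ∧ ∀ᵐ z ∂π, z.1 ≤ z.2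

/-- A Markov kernel between ordered spaces is increasing when `x ≤ x'` implies that its value at
`x` is stochastically dominated by its value at `x'`. -/
def IsIncreasingKernel {A B : Type*} [MeasurableSpace A] [MeasurableSpace B] [Preorder A]
    [Preorder B] (K : Kernel A B) : Prop :=
  ∀ x x' : A, x ≤ x' → StochDominated (K x) (K x')

variable {Ω : Type*} [mΩ : MeasurableSpace Ω] {A : ℕ → Type*} [∀ n, MeasurableSpace (A n)]

/-- `(X n)` is a Markov process, with respect to the filtration it generates, whose transition
probabilities from time `-(n+1)` to time `-n` are given by the Markov kernels `K n`. -/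
def IsMarkovProcessWith (P : Measure Ω) (X : ∀ n, Ω → A n) (hX : ∀ n, Measurable (X n))
    (K : ∀ n, Kernel (A (n + 1)) (A n)) : Prop :=
  ∀ n, IsMarkovKernel (K n) ∧ ∀ B : Set (A n), MeasurableSet B →
    P⟦X n ⁻¹' B | pastFiltration X hX (toDual (n + 1))⟧ =ᵐ[P]
      fun ω => (K n (X (n + 1) ω)).real B

/-- A monotonic Markov process: a Markov process whose transition kernels are increasing. -/
def IsMonotonicMarkovProcess [∀ n, Preorder (A n)] (P : Measure Ω) (X : ∀ n, Ω → A n)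
    (hX : ∀ n, Measurable (X n)) : Prop :=
  ∃ K : ∀ n, Kernel (A (n + 1)) (A n),
    IsMarkovProcessWith P X hX K ∧ ∀ n, IsIncreasingKernel (K n)

end MonotonicMarkov

section PascalGraph

/-- The vertices `0, 1, …, n` at level `-n` of the Pascal graph. -/
abbrev PascalVertex (n : ℕ) : Type := Fin (n + 1)

/-- The edges between levels `-n` and `-(n+1)` of the Pascal graph: the vertex `v` at level `-n` is
connected to the vertices `v` and `v + 1` at level `-(n+1)`. -/
abbrev PascalEdge (n : ℕ) : Type :=
  {e : PascalVertex n × PascalVertex (n + 1) // e.2.val = e.1.val ∨ e.2.val = e.1.val + 1}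

/-- The infinite paths of the Pascal graph: sequences of connected edges starting at the root (the
only vertex at level `0`). The σ-field is the trace of the product σ-field. -/
abbrev PascalPath : Type :=
  {γ : ∀ n, PascalEdge n // ∀ n, (γ n).1.2 = (γ (n + 1)).1.1}

/-- The edge of a path between levels `-n` and `-(n+1)`. -/
def pascalEdge (n : ℕ) (γ : PascalPath) : PascalEdge n := γ.1 n

/-- The random walk on the vertices: the vertex at level `-n` of a path. -/
def pascalWalk (n : ℕ) (γ : PascalPath) : PascalVertex n := (γ.1 n).1.1

lemma measurable_pascalEdge (n : ℕ) : Measurable (pascalEdge n) :=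
  (measurable_pi_apply n).comp measurable_subtype_coe

lemma measurable_pascalWalk (n : ℕ) : Measurable (pascalWalk n) :=
  measurable_fst.comp (measurable_subtype_coe.comp (measurable_pascalEdge n))

/-- The number of ones among the first `n` bits. -/
def countOnes (b : ℕ → Bool) (n : ℕ) : ℕ := ∑ j ∈ Finset.range n, (b j).toNat

lemma countOnes_succ (b : ℕ → Bool) (n : ℕ) :
    countOnes b (n + 1) = countOnes b n + (b n).toNat := Finset.sum_range_succ _ _

lemma countOnes_lt (b : ℕ → Bool) (n : ℕ) : countOnes b n < n + 1 := by
  induction n with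
  | zero => simp [countOnes]
  | succ n ih => rw [countOnes_succ]; have := Bool.toNat_le (b n); omega

lemma measurable_countOnes (n : ℕ) : Measurable fun b : ℕ → Bool => countOnes b n :=
  Finset.measurable_sum _ fun j _ => (measurable_of_countable Bool.toNat).comp
    (measurable_pi_apply j)

lemma measurable_countOnes_fin (n : ℕ) :
    Measurable fun b : ℕ → Bool => (⟨countOnes b n, countOnes_lt b n⟩ : PascalVertex n) := by
  refine measurable_to_countable' fun k => ?_
  have : (fun b : ℕ → Bool => (⟨countOnes b n, countOnes_lt b n⟩ : PascalVertex n)) ⁻¹' {k} =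
      (fun b => countOnes b n) ⁻¹' {k.val} := by
    ext b; simp [Fin.ext_iff]
  rw [this]
  exact measurable_countOnes n (measurableSet_singleton _)

/-- The path coded by a sequence of bits: the bit `b n` tells whether the edge which leaves the
vertex `v` at level `-n` goes to `v` (bit `0`) or to `v + 1` (bit `1`) at level `-(n+1)`. -/
def pascalPathOfBits (b : ℕ → Bool) : PascalPath :=
  ⟨fun n => ⟨(⟨countOnes b n, countOnes_lt b n⟩, ⟨countOnes b (n + 1), countOnes_lt b (n + 1)⟩), by
    show countOnes b (n + 1) = countOnes b n ∨ countOnes b (n + 1) = countOnes b n + 1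
    rw [countOnes_succ]; cases b n <;> simp⟩, fun _ => rfl⟩

/-- The sequence of bits which codes a path. -/
def bitsOfPascalPath (γ : PascalPath) (n : ℕ) : Bool :=
  decide ((pascalEdge n γ).1.2.val = (pascalEdge n γ).1.1.val + 1)

lemma pascalWalk_val (γ : PascalPath) (n : ℕ) :
    (pascalWalk n γ).val = countOnes (bitsOfPascalPath γ) n := by
  induction n with
  | zero => have := (pascalWalk 0 γ).isLt; simp only [countOnes, Finset.range_zero,
      Finset.sum_empty]; omega
  | succ n ih =>
    have h1 : pascalWalk (n + 1) γ = (pascalEdge n γ).1.2 := (γ.2 n).symm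
    have h2 : pascalWalk n γ = (pascalEdge n γ).1.1 := rfl
    rw [countOnes_succ, ← ih, h1, h2, bitsOfPascalPath]
    rcases (pascalEdge n γ).2 with h | h <;> simp [h]

/-- The natural identification of `{0,1}^ℕ` with the path space of the Pascal graph. -/
def pascalPathEquiv : (ℕ → Bool) ≃ᵐ PascalPath where
  toFun := pascalPathOfBits
  invFun := bitsOfPascalPath
  left_inv b := by
    funext n
    simp only [bitsOfPascalPath, pascalEdge, pascalPathOfBits, countOnes_succ]
    cases b n <;> simp
  right_inv γ := by
    apply Subtype.ext
    funext n
    apply Subtype.ext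
    have h1 := pascalWalk_val γ n
    have h2 := pascalWalk_val γ (n + 1)
    have h3 : pascalWalk (n + 1) γ = (γ.1 n).1.2 := (γ.2 n).symm
    rw [h3] at h2
    exact Prod.ext (Fin.ext h1.symm) (Fin.ext h2.symm)
  measurable_toFun := by
    refine Measurable.subtype_mk (measurable_pi_lambda _ fun n => Measurable.subtype_mk ?_)
    exact (measurable_countOnes_fin n).prodMk (measurable_countOnes_fin (n + 1))
  measurable_invFun := by
    refine measurable_pi_lambda _ fun n => ?_
    exact (measurable_of_countable fun e : PascalEdge n =>
      decide (e.1.2.val = e.1.1.val + 1)).comp (measurable_pascalEdge n)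

/-- The infinite product Bernoulli measure `(p, 1 - p)` on the path space of the Pascal graph: the
bits are independent, each of them being `1` with probability `p` and `0` with probability
`1 - p`. -/
noncomputable def pascalBernoulli (p : unitInterval) : Measure PascalPath :=
  (Measure.infinitePi fun _ : ℕ => bernoulliMeasure true false p).map pascalPathEquiv

/-- A probability measure on the path space is ergodic when the filtration generated by the
edges of the random path is Kolmogorovian. The edge between levels `-(n+1)` and `-n` is the
value at time `-n` of the edge process. -/
def IsErgodicPascal (μ : Measure PascalPath) : Prop :=
  IsKolmogorovian μ (pastFiltration pascalEdge measurable_pascalEdge)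

end PascalGraph

/-! Read towards the root, the walk no longer depends on `p`. By Bayes, from `y` at level `-(n+1)`
it goes to `y - 1` with probability `y/(n+1)` and stays at `y` otherwise
(`binomialProb_mul_forwardProb`). A rank `i` uniform on `{0, …, n}` realizes this move, going down
iff `i < y`. For a fixed rank the move is increasing in `y`, so sharing the rank couples the
transition laws monotonically.

For standardness the walk must be a function of the ranks alone. Two descents driven by the same
ranks keep their order, and each step to level `-n` multiplies their mean distance by exactly
`n/(n+1)`. From level `-m` to level `-n` the factors telescope to `n/m`
(`lintegral_dist_descend_le`). By the law of large numbers the walk at level `-m` is at mean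
distance `o(m)` from the deterministic vertex `⌊p m⌋`. The descents from these two vertices
therefore meet before level `-n` with probability tending to 1. Borel–Cantelli along a fast
subsequence makes the descents from deterministic vertices stabilize almost surely.

The limit is adapted to the filtration of the independent ranks, has the law of the walk and obeys
the one-step recursion (`exists_rank_adapted_walk`). Each rank is independent of the earlier ones,
so conditioning on all past ranks or only on the past of the limit gives the same transition law:
this is both the Markov property and immersion. Kolmogorov's 0-1 law for the ranks gives a trivial
tail, which transfers to the walk by equality of laws. -/

/-! ### Generated filtrations and transfer of tail triviality -/

section FiltrationTransfer

variable {Ω : Type*} [mΩ : MeasurableSpace Ω] {E : ℕ → Type*} [∀ n, MeasurableSpace (E n)]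

/-- The filtration generated by the coordinate process on a product space. -/
abbrev canonicalFiltration (E : ℕ → Type*) [∀ n, MeasurableSpace (E n)] :
    Filtration ℕᵒᵈ (inferInstance : MeasurableSpace (∀ n, E n)) :=
  pastFiltration (fun n (x : ∀ n, E n) => x n) measurable_pi_apply

lemma measurable_pastFiltration (X : ∀ n, Ω → E n) (hX : ∀ n, Measurable (X n)) {n j : ℕ}
    (h : n ≤ j) : Measurable[pastFiltration X hX (toDual n)] (X j) :=
  @Measurable.of_comap_le _ _ (_) _ _ (le_iSup₂_of_le (f := fun (j : ℕ) (_ : n ≤ j) =>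
    MeasurableSpace.comap (X j) inferInstance) j h le_rfl)

lemma pastFiltration_le_of_measurable {Ω : Type*} (m : MeasurableSpace Ω)
    {_mΩ : MeasurableSpace Ω} (X : ∀ n, Ω → E n) (hX : ∀ n, Measurable (X n)) {n : ℕ}
    (h : ∀ j, n ≤ j → Measurable[m] (X j)) :
    pastFiltration X hX (toDual n) ≤ m :=
  iSup₂_le fun j hj => @Measurable.comap_le _ _ m _ _ (h j hj)

lemma pastFiltration_eq_comap (X : ∀ n, Ω → E n) (hX : ∀ n, Measurable (X n)) (k : ℕᵒᵈ) :
    pastFiltration X hX k = (canonicalFiltration E k).comap (fun ω n => X n ω) := by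
  change (⨆ j : ℕ, ⨆ _ : ofDual k ≤ j, MeasurableSpace.comap (X j) inferInstance) =
    (⨆ j : ℕ, ⨆ _ : ofDual k ≤ j,
      MeasurableSpace.comap (fun x : ∀ n, E n => x j) inferInstance).comap _
  simp only [MeasurableSpace.comap_iSup, MeasurableSpace.comap_comp]
  rfl

lemma pastFiltration_eq_sup (X : ∀ n, Ω → E n) (hX : ∀ n, Measurable (X n)) (n : ℕ) :
    pastFiltration X hX (toDual n) =
      MeasurableSpace.comap (X n) inferInstance ⊔ pastFiltration X hX (toDual (n + 1)) := by
  apply le_antisymm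
  · refine iSup₂_le fun j (hj : n ≤ j) => ?_
    rcases hj.eq_or_lt with rfl | h
    · exact le_sup_left
    · exact le_sup_of_le_right (measurable_pastFiltration X hX h).comap_le
  · exact sup_le (measurable_pastFiltration X hX le_rfl).comap_le
      ((pastFiltration X hX).mono (toDual_le_toDual.mpr n.le_succ))

lemma IsKolmogorovian.mono {P : Measure Ω} {F G : Filtration ℕᵒᵈ mΩ} (h : F ≤ G)
    (hG : IsKolmogorovian P G) : IsKolmogorovian P F := by
  intro s hs
  refine hG s ?_
  rw [MeasurableSpace.measurableSet_iInf] at hs ⊢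
  exact fun k => h k s (hs k)

/-- Kolmogorov's 0-1 law: the tail is the limsup of the σ-fields of the independent variables. -/
lemma IsProductType.isKolmogorovian {P : Measure Ω} {G : Filtration ℕᵒᵈ mΩ}
    (h : IsProductType P G) : IsKolmogorovian P G := by
  obtain ⟨E, _, U, hU, hind, rfl⟩ := h
  intro s hs
  refine measure_zero_or_one_of_measurableSet_limsup_atTop (fun n => (hU n).comap_le)
    (hind.iIndep) ?_
  rw [Filter.limsup_eq_iInf_iSup_of_nat]
  exact hs

lemma IsKolmogorovian.canonical {P : Measure Ω} {X : ∀ n, Ω → E n} {hX : ∀ n, Measurable (X n)}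
    (h : IsKolmogorovian P (pastFiltration X hX)) :
    IsKolmogorovian (P.map fun ω n => X n ω) (canonicalFiltration E) := by
  intro s hs
  rw [MeasurableSpace.measurableSet_iInf] at hs
  rw [Measure.map_apply (measurable_pi_lambda _ hX)
    ((canonicalFiltration E).le (toDual 0) s (hs _))]
  refine h _ ?_
  rw [MeasurableSpace.measurableSet_iInf]
  intro k
  rw [pastFiltration_eq_comap]
  exact ⟨s, hs k, rfl⟩

/-- A tail event `s` is, for each `n`, the preimage of some `t n` in the canonical σ-field at time
`-n`, but `t n` may vary with `n`. The limsup of the `t n` ignores any finite number of them, so it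
is a tail event, and its preimage is still `s`. -/
lemma IsKolmogorovian.of_canonical {P : Measure Ω} {X : ∀ n, Ω → E n}
    {hX : ∀ n, Measurable (X n)}
    (h : IsKolmogorovian (P.map fun ω n => X n ω) (canonicalFiltration E)) :
    IsKolmogorovian P (pastFiltration X hX) := by
  intro s hs
  rw [MeasurableSpace.measurableSet_iInf] at hs
  have hs' : ∀ n : ℕ, ∃ t, MeasurableSet[canonicalFiltration E (toDual n)] t ∧
      (fun ω n => X n ω) ⁻¹' t = s := by
    intro n
    have := hs (toDual n)
    rw [pastFiltration_eq_comap] at this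
    exact this
  choose t ht hts using hs'
  have hmeas : ∀ k : ℕ, MeasurableSet[canonicalFiltration E (toDual k)]
      (Filter.limsup t Filter.atTop) := by
    intro k
    rw [← Filter.limsup_nat_add t k]
    refine @MeasurableSet.measurableSet_limsup _ (canonicalFiltration E (toDual k)) _ fun n => ?_
    exact (canonicalFiltration E).mono (toDual_le_toDual.mpr (Nat.le_add_left k n)) _ (ht _)
  have hpre : (fun ω n => X n ω) ⁻¹' (Filter.limsup t Filter.atTop) = s := by
    ext ω
    have : ∀ n, (fun n => X n ω) ∈ t n ↔ ω ∈ s := fun n => by rw [← hts n]; rfl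
    simp only [Filter.limsup_eq_iInf_iSup_of_nat, Set.iInf_eq_iInter, Set.iSup_eq_iUnion,
      Set.mem_preimage, Set.mem_iInter, Set.mem_iUnion, this]
    exact ⟨fun h => (h 0).choose_spec.2, fun h i => ⟨i, le_rfl, h⟩⟩
  rw [← hpre, ← Measure.map_apply (measurable_pi_lambda _ hX)
    ((canonicalFiltration E).le (toDual 0) _ (hmeas 0))]
  refine h _ ?_
  rw [MeasurableSpace.measurableSet_iInf]
  exact fun k => hmeas (ofDual k)

end FiltrationTransfer

/-! ### Conditional expectations: transfer by law, independence, conditional independence -/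

section CondExp

lemma condExp_map_comp {Ω Ω' : Type*} {m mΩ' : MeasurableSpace Ω'} {mΩ : MeasurableSpace Ω} {P : Measure Ω} [IsFiniteMeasure P] {X : Ω → Ω'} (hX : Measurable X)
    (hm : m ≤ mΩ') {f : Ω' → ℝ} (hf : Integrable f (P.map X)) :
    (P.map X)[f | m] ∘ X =ᵐ[P] P[f ∘ X | m.comap X] := by
  have hle : m.comap X ≤ mΩ := (MeasurableSpace.comap_mono hm).trans hX.comap_le
  have hint : Integrable ((P.map X)[f | m] ∘ X) P := integrable_condExp.comp_measurable hX
  refine ae_eq_condExp_of_forall_setIntegral_eq hle (hf.comp_measurable hX)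
    (fun _ _ _ => hint.integrableOn) ?_ ?_
  · rintro _ ⟨s, hs, rfl⟩ -
    have h1 := setIntegral_map (μ := P) (f := (P.map X)[f | m]) (hm s hs)
      integrable_condExp.aestronglyMeasurable hX.aemeasurable
    have h2 := setIntegral_map (μ := P) (f := f) (hm s hs)
      hf.aestronglyMeasurable hX.aemeasurable
    simp only [Function.comp_def]
    rw [← h1, ← h2, setIntegral_condExp hm hf hs]
  · exact (stronglyMeasurable_condExp.comp_measurable
      (comap_measurable X)).aestronglyMeasurable

variable {Ω Ω' : Type*} [mΩ : MeasurableSpace Ω] [mΩ' : MeasurableSpace Ω']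
  {A : ℕ → Type*} [∀ n, MeasurableSpace (A n)]

/-- The Markov property depends only on the law of the process, since conditional expectations pull
back along the map to the path space. -/
lemma isMarkovProcessWith_iff_canonical {P : Measure Ω} [IsFiniteMeasure P] {X : ∀ n, Ω → A n}
    {hX : ∀ n, Measurable (X n)} {K : ∀ n, Kernel (A (n + 1)) (A n)} :
    IsMarkovProcessWith P X hX K ↔
      IsMarkovProcessWith (P.map fun ω n => X n ω) (fun n x => x n) measurable_pi_apply K := by
  have hXm : Measurable fun ω n => X n ω := measurable_pi_lambda _ hX
  refine forall_congr' fun n => and_congr_right fun hK => forall₂_congr fun B hB => ?_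
  have hint : Integrable (((fun x : ∀ n, A n => x n) ⁻¹' B).indicator fun _ => (1 : ℝ))
      (P.map fun ω n => X n ω) :=
    (integrable_const _).indicator (measurable_pi_apply n hB)
  have h1 := condExp_map_comp (P := P) hXm (m := canonicalFiltration A (toDual (n + 1)))
    ((canonicalFiltration A).le (toDual (n + 1))) hint
  rw [← pastFiltration_eq_comap X hX] at h1
  have hmeas : MeasurableSet {x : ∀ n, A n | ((P.map fun ω n => X n ω)⟦(fun x : ∀ n, A n => x n) ⁻¹' B |
      canonicalFiltration A (toDual (n + 1))⟧) x = (K n (x (n + 1))).real B} := by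
    refine measurableSet_eq_fun ?_ ?_
    · exact (stronglyMeasurable_condExp.mono
        ((canonicalFiltration A).le (toDual (n + 1)))).measurable
    · exact (Kernel.measurable_coe (K n) hB).ennreal_toReal.comp (measurable_pi_apply (n + 1))
  have h2 : (P⟦X n ⁻¹' B | pastFiltration X hX (toDual (n + 1))⟧) =ᵐ[P]
      fun ω => ((P.map fun ω n => X n ω)⟦(fun x : ∀ n, A n => x n) ⁻¹' B |
      canonicalFiltration A (toDual (n + 1))⟧) (fun n => X n ω) := h1.symm
  rw [Filter.EventuallyEq, Filter.EventuallyEq, ae_map_iff hXm.aemeasurable hmeas]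
  exact ⟨fun h => by filter_upwards [h, h2] with ω a b; rw [← a, ← b],
    fun h => by filter_upwards [h, h2] with ω a b; rw [← a, ← b]⟩

lemma IsMarkovProcessWith.of_map_eq {P : Measure Ω} [IsFiniteMeasure P] {P' : Measure Ω'}
    [IsFiniteMeasure P'] {X : ∀ n, Ω → A n} {hX : ∀ n, Measurable (X n)}
    {X' : ∀ n, Ω' → A n} {hX' : ∀ n, Measurable (X' n)} {K : ∀ n, Kernel (A (n + 1)) (A n)}
    (h : IsMarkovProcessWith P' X' hX' K)
    (hmap : P.map (fun ω n => X n ω) = P'.map (fun ω n => X' n ω)) :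
    IsMarkovProcessWith P X hX K := by
  rw [isMarkovProcessWith_iff_canonical] at h ⊢
  rwa [hmap]

/-- If `U` is independent of `m` and `Y` is `m`-measurable, then the conditional law of `f U Y`
given `m` is the law of `f U y` at `y = Y`. -/
lemma condExp_preimage_of_indep {Ω I B C : Type*} {m mΩ : MeasurableSpace Ω}
    {P : Measure Ω} [IsProbabilityMeasure P] [MeasurableSpace I] [Fintype B] [MeasurableSpace B]
    [MeasurableSingletonClass B] (hm : m ≤ mΩ)
    {U : Ω → I} (hU : Measurable U) (hind : Indep (MeasurableSpace.comap U inferInstance) m P)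
    {Y : Ω → B} (hY : Measurable[m] Y) {f : I → B → C} {S : Set C}
    (hf : ∀ y, MeasurableSet {i | f i y ∈ S}) :
    P⟦(fun ω => f (U ω) (Y ω)) ⁻¹' S | m⟧ =ᵐ[P] fun ω => (P.map U).real {i | f i (Y ω) ∈ S} := by
  classical
  -- Splitting over the finitely many values `y` of `Y` freezes the second argument of `f`; each
  -- piece is an `m`-measurable indicator times a function of `U`.
  have hsum : ((fun ω => f (U ω) (Y ω)) ⁻¹' S).indicator (fun _ => (1 : ℝ)) =
      ∑ y : B, (Y ⁻¹' {y}).indicator ((U ⁻¹' {i | f i y ∈ S}).indicator fun _ => (1 : ℝ)) := by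
    ext ω
    rw [Finset.sum_apply, Finset.sum_eq_single (Y ω)]
    · simp [Set.indicator]
    · intro y _ hy
      exact Set.indicator_of_notMem (fun h => hy h.symm) _
    · simp
  have hint : ∀ y, Integrable ((U ⁻¹' {i | f i y ∈ S}).indicator fun _ => (1 : ℝ)) P :=
    fun y => (integrable_const _).indicator (hU (hf y))
  have hYs : ∀ y, MeasurableSet[m] (Y ⁻¹' {y}) := fun y => hY (measurableSet_singleton y)
  rw [hsum]
  refine (condExp_finsetSum (fun y _ => (hint y).indicator (hm _ (hYs y))) m).trans ?_
  have h1 : ∀ y, P[(Y ⁻¹' {y}).indicator ((U ⁻¹' {i | f i y ∈ S}).indicator fun _ => (1 : ℝ)) | m]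
      =ᵐ[P] (Y ⁻¹' {y}).indicator fun _ => (P.map U).real {i | f i y ∈ S} := by
    intro y
    refine (condExp_indicator (hint y) (hYs y)).trans ?_
    have h2 := condExp_indep_eq (μ := P) hU.comap_le hm
      (f := (U ⁻¹' {i | f i y ∈ S}).indicator fun _ => (1 : ℝ))
      (stronglyMeasurable_const.indicator (comap_measurable U (hf y))) hind
    filter_upwards [h2] with ω h
    by_cases hω : ω ∈ Y ⁻¹' {y}
    · rw [Set.indicator_of_mem hω, Set.indicator_of_mem hω, h,
        integral_indicator_const _ (hU (hf y)), map_measureReal_apply hU (hf y)]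
      simp
    · rw [Set.indicator_of_notMem hω, Set.indicator_of_notMem hω]
  filter_upwards [ae_all_iff.mpr h1] with ω h
  rw [Finset.sum_apply, Finset.sum_congr rfl fun y _ => h y, Finset.sum_eq_single (Y ω)]
  · simp
  · intro y _ hy
    exact Set.indicator_of_notMem (fun h => hy h.symm) _
  · simp

/-- By the tower property, for `a` in `m₁` and `s` in `m₂`, conditioning first on `m₂` turns `1_a`
into `P⟦a | m⟧`, which factors out given `m`. Sets of `m` factor out as well, so the product formula
holds on the π-system of intersections `a ∩ t` generating `m₁ ⊔ m`. -/
lemma condIndep_sup_of_condExp_eq {Ω : Type*} {m m₁ m₂ mΩ : MeasurableSpace Ω}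
    [StandardBorelSpace Ω] {P : Measure Ω} [IsFiniteMeasure P] (hm : m ≤ m₂) (hm₁ : m₁ ≤ mΩ) (hm₂ : m₂ ≤ mΩ)
    (h : ∀ t, MeasurableSet[m₁] t → P⟦t | m₂⟧ =ᵐ[P] P⟦t | m⟧) :
    CondIndep m (m₁ ⊔ m) m₂ (hm.trans hm₂) P := by
  have hmΩ := hm.trans hm₂
  have hint : ∀ t, MeasurableSet t → Integrable (t.indicator fun _ => (1 : ℝ)) P :=
    fun t ht => (integrable_const _).indicator ht
  let p : Set (Set Ω) := {r | ∃ a t, MeasurableSet[m₁] a ∧ MeasurableSet[m] t ∧ r = a ∩ t}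
  refine CondIndepSets.condIndep (p1 := p) (p2 := {s | MeasurableSet[m₂] s})
    (sup_le hm₁ hmΩ) hm₂ ?_ (@MeasurableSpace.isPiSystem_measurableSet _ m₂) ?_
    (@MeasurableSpace.generateFrom_measurableSet _ m₂).symm ?_
  · rintro _ ⟨a, t, ha, ht, rfl⟩ _ ⟨a', t', ha', ht', rfl⟩ -
    exact ⟨a ∩ a', t ∩ t', ha.inter ha', ht.inter ht', Set.inter_inter_inter_comm _ _ _ _⟩
  · apply le_antisymm
    · refine sup_le (fun a ha => ?_) fun t ht => ?_
      · exact MeasurableSpace.measurableSet_generateFrom ⟨a, Set.univ, ha, .univ, by simp⟩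
      · exact MeasurableSpace.measurableSet_generateFrom ⟨Set.univ, t, .univ, ht, by simp⟩
    · refine MeasurableSpace.generateFrom_le ?_
      rintro _ ⟨a, t, ha, ht, rfl⟩
      exact ((le_sup_left : m₁ ≤ m₁ ⊔ m) a ha).inter ((le_sup_right : m ≤ m₁ ⊔ m) t ht)
  · rw [condIndepSets_iff m hmΩ p {s | MeasurableSet[m₂] s} ?_ (fun s hs => hm₂ s hs)]
    · rintro _ s ⟨a, t, ha, ht, rfl⟩ hs
      have ha' := hm₁ a ha
      have hs' := hm₂ s hs
      have e1 : P⟦a ∩ s | m⟧ =ᵐ[P] P⟦a | m⟧ * P⟦s | m⟧ := by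
        have i1 : (a ∩ s).indicator (fun _ => (1 : ℝ)) = s.indicator (a.indicator fun _ => 1) := by
          rw [Set.indicator_indicator, Set.inter_comm]
        have i2 : s.indicator (P⟦a | m⟧) = P⟦a | m⟧ * s.indicator fun _ => (1 : ℝ) := by
          ext ω; by_cases hω : ω ∈ s <;> simp [hω]
        have c1 : P⟦a ∩ s | m₂⟧ =ᵐ[P] s.indicator (P⟦a | m⟧) := by
          rw [i1]
          refine (condExp_indicator (hint a ha') hs).trans ?_
          filter_upwards [h a ha] with ω hω
          by_cases hωs : ω ∈ s <;> simp [hωs, hω]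
        refine (condExp_condExp_of_le hm hm₂).symm.trans ((condExp_congr_ae c1).trans ?_)
        rw [i2]
        refine condExp_mul_of_stronglyMeasurable_left stronglyMeasurable_condExp ?_ (hint s hs')
        rw [← i2]
        exact integrable_condExp.indicator hs'
      have i3 : (a ∩ t ∩ s).indicator (fun _ => (1 : ℝ)) =
          t.indicator ((a ∩ s).indicator fun _ => 1) := by
        rw [Set.indicator_indicator]; congr 1; ext; simp; tauto
      have i4 : (a ∩ t).indicator (fun _ => (1 : ℝ)) = t.indicator (a.indicator fun _ => 1) := by
        rw [Set.indicator_indicator, Set.inter_comm]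
      rw [i3, i4]
      filter_upwards [e1, condExp_indicator (hint _ (ha'.inter hs')) ht,
        condExp_indicator (hint _ ha') ht] with ω h1 h2 h3
      rw [h2, Pi.mul_apply, h3]
      by_cases hω : ω ∈ t
      · simp [hω, h1]
      · simp [hω]
    · rintro _ ⟨a, t, ha, ht, rfl⟩
      exact (hm₁ a ha).inter (hmΩ t ht)

end CondExp

/-! ### The backward dynamics driven by ranks -/

section Descent

/-- Backward move in the Pascal graph: from the vertex `y` at level `-(n+1)` one moves to `y - 1`
when the rank `i` is less than `y`, and to `y` otherwise. -/
def pascalStep (i y : ℕ) : ℕ := if i < y then y - 1 else y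

/-- The vertex at level `-n` obtained from the vertex `x` at level `-(n+k)` by performing `k`
backward moves with the ranks `u`. -/
def descend (u : ∀ n : ℕ, Fin (n + 1)) : ℕ → ℕ → ℕ → ℕ
  | _, 0, x => x
  | n, k + 1, x => pascalStep (u n) (descend u (n + 1) k x)

lemma pascalStep_le {n i y : ℕ} (hi : i ≤ n) (hy : y ≤ n + 1) : pascalStep i y ≤ n := by
  unfold pascalStep; split_ifs <;> omega

lemma pascalStep_mono (i : ℕ) : Monotone (pascalStep i) := by
  intro y z h
  unfold pascalStep; split_ifs <;> omega

lemma val_predAbove {n : ℕ} (i : Fin (n + 1)) (y : Fin (n + 2)) :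
    (i.predAbove y).val = pascalStep i y := by
  unfold pascalStep Fin.predAbove
  by_cases h : i.castSucc < y
  · have h' : i.val < y.val := Fin.lt_def.mp h
    simp [h, h']
  · have h' : ¬ i.val < y.val := fun h' => h (Fin.lt_def.mpr h')
    simp [h, h']

lemma descend_le (u : ∀ n : ℕ, Fin (n + 1)) {n k x : ℕ} (hx : x ≤ n + k) :
    descend u n k x ≤ n := by
  induction k generalizing n with
  | zero => exact hx
  | succ k ih => exact pascalStep_le (Nat.lt_succ_iff.mp (u n).isLt) (ih (by omega))

lemma descend_add (u : ∀ n : ℕ, Fin (n + 1)) (n k l x : ℕ) :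
    descend u n (k + l) x = descend u n k (descend u (n + k) l x) := by
  induction k generalizing n with
  | zero => simp [descend]
  | succ k ih =>
    rw [show k + 1 + l = (k + l) + 1 by omega, descend, ih, descend]
    rw [show n + 1 + k = n + (k + 1) by omega]

/-- Prescribing the whole trajectory constrains the starting point and each rank separately, so the
event is a rectangle for the product measure. -/
lemma descend_eq_iff (u : ∀ n : ℕ, Fin (n + 1)) (m x : ℕ) (v : ℕ → ℕ) :
    (∀ j ≤ m, descend u j (m - j) x = v j) ↔
      x = v m ∧ ∀ j < m, pascalStep (u j) (v (j + 1)) = v j := by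
  have step : ∀ j < m, descend u j (m - j) x =
      pascalStep (u j) (descend u (j + 1) (m - (j + 1)) x) := by
    intro j hj
    rw [show m - j = (m - (j + 1)) + 1 by omega, descend]
  constructor
  · intro h
    refine ⟨by simpa [descend] using h m le_rfl, fun j hj => ?_⟩
    rw [← h (j + 1) hj, ← step j hj, h j hj.le]
  · rintro ⟨h1, h2⟩ j hj
    induction hd : m - j generalizing j with
    | zero =>
      obtain rfl : j = m := by omega
      exact h1
    | succ d ih =>
      have hjm : j < m := by omega
      rw [← hd, step j hjm, show m - (j + 1) = d by omega, ih (j + 1) hjm (by omega), h2 j hjm]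

/-- The filtration is left general because the ranks are used alone, together with the bits, and in
the full σ-field. -/
lemma measurable_descend {Ω : Type*} {mΩ : MeasurableSpace Ω} (F : Filtration ℕᵒᵈ mΩ)
    {U : ∀ n : ℕ, Ω → Fin (n + 1)} (hU : ∀ n, Measurable[F (toDual n)] (U n)) {n k : ℕ}
    {x : Ω → ℕ} (hx : Measurable[F (toDual (n + k))] x) :
    Measurable[F (toDual n)] fun ω => descend (fun n => U n ω) n k (x ω) := by
  induction k generalizing n with
  | zero => exact hx
  | succ k ih =>
    have h1 : Measurable[F (toDual n)] fun ω => descend (fun n => U n ω) (n + 1) k (x ω) := by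
      refine (ih (by rwa [show n + 1 + k = n + (k + 1) by omega])).mono
        (F.mono (toDual_le_toDual.mpr n.le_succ)) le_rfl
    have h2 : Measurable[F (toDual n)] fun ω =>
        (U n ω, descend (fun n => U n ω) (n + 1) k (x ω)) := (hU n).prodMk h1
    have h3 : Measurable fun q : Fin (n + 1) × ℕ => pascalStep q.1 q.2 :=
      measurable_of_countable _
    exact h3.comp h2

end Descent

/-! ### Time reversal: descents from the binomial law have the law of the walk -/

section Law

lemma countOnes_congr {b b' : ℕ → Bool} {n : ℕ} (h : ∀ i < n, b i = b' i) :
    countOnes b n = countOnes b' n :=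
  Finset.sum_congr rfl fun i hi => by rw [h i (Finset.mem_range.mp hi)]

/-- The law of a sequence of independent bits with parameter `p`. -/
noncomputable def bitsMeasure (p : unitInterval) : Measure (ℕ → Bool) :=
  Measure.infinitePi fun _ : ℕ => bernoulliMeasure true false p

instance (p : unitInterval) : IsProbabilityMeasure (bitsMeasure p) := by
  unfold bitsMeasure; infer_instance

/-- The uniform law on `{0, …, n}`. -/
noncomputable def rankMeasure (n : ℕ) : Measure (Fin (n + 1)) :=
  (PMF.uniformOfFintype (Fin (n + 1))).toMeasure

instance (n : ℕ) : IsProbabilityMeasure (rankMeasure n) := by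
  unfold rankMeasure; infer_instance

/-- The law of a sequence of independent uniform ranks. -/
noncomputable def ranksMeasure : Measure (∀ n : ℕ, Fin (n + 1)) :=
  Measure.infinitePi rankMeasure

instance : IsProbabilityMeasure ranksMeasure := by
  unfold ranksMeasure; infer_instance

lemma rankMeasure_real (n : ℕ) (s : Set (Fin (n + 1))) :
    (rankMeasure n).real s = (Set.ncard s : ℝ) / (n + 1) := by
  classical
  rw [measureReal_def, rankMeasure, PMF.toMeasure_uniformOfFintype_apply _ (Set.toFinite s).measurableSet,
    ENNReal.toReal_div]
  simp only [Set.ncard_eq_toFinset_card', Set.toFinset_card, Fintype.card_fin,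
    ENNReal.toReal_natCast]
  push_cast
  rfl

lemma bitsMeasure_real_inter (p : unitInterval) {m : ℕ} {s : Set (ℕ → Bool)}
    (hs : ∀ b b' : ℕ → Bool, (∀ i < m, b i = b' i) → b ∈ s → b' ∈ s) (t : Set Bool) :
    (bitsMeasure p).real (s ∩ {b | b m ∈ t}) =
      (bitsMeasure p).real s * (bernoulliMeasure true false p).real t := by
  have hind : iIndepFun (fun (i : ℕ) (b : ℕ → Bool) => b i) (bitsMeasure p) :=
    iIndepFun_infinitePi (X := fun _ x => x) fun _ => measurable_id
  have h1 := hind.indepFun_finset (Finset.range m) {m} (by simp) measurable_pi_apply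
  -- Padding with `false` displays `s` as a cylinder over the first `m` bits, since `s` ignores the
  -- others; measurability is then automatic on a finite space.
  let ext (c : Finset.range m → Bool) (i : ℕ) : Bool := if h : i ∈ Finset.range m then c ⟨i, h⟩ else false
  have hs' : s = (fun b (i : Finset.range m) => b i) ⁻¹' {c | ext c ∈ s} := by
    ext b
    constructor
    · refine hs _ _ fun i hi => ?_
      simp [ext, hi]
    · refine hs _ _ fun i hi => ?_
      simp [ext, hi]
  have ht' : {b : ℕ → Bool | b m ∈ t} = (fun b (i : ({m} : Finset ℕ)) => b i) ⁻¹'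
      {c | c ⟨m, by simp⟩ ∈ t} := rfl
  have h2 := (indepFun_iff_measure_inter_preimage_eq_mul.mp h1) {c | ext c ∈ s}
    {c | c ⟨m, by simp⟩ ∈ t} (Set.toFinite _).measurableSet (Set.toFinite _).measurableSet
  rw [← hs', ← ht'] at h2
  rw [measureReal_def, h2, ENNReal.toReal_mul, ← measureReal_def, ← measureReal_def]
  congr 1
  rw [← Measure.infinitePi_map_eval (fun _ : ℕ => bernoulliMeasure true false p) m,
    map_measureReal_apply (measurable_pi_apply m) t.toFinite.measurableSet]
  rfl

/-- The probability of moving from `x` to `y` when going away from the root. -/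
noncomputable def forwardProb (p : unitInterval) (x y : ℕ) : ℝ :=
  (bernoulliMeasure true false p).real {b | x + b.toNat = y}

lemma forwardProb_self (p : unitInterval) (x : ℕ) : forwardProb p x x = 1 - p := by
  simp [forwardProb]

lemma forwardProb_succ (p : unitInterval) (x : ℕ) : forwardProb p x (x + 1) = p := by
  simp [forwardProb]

lemma forwardProb_of_ne (p : unitInterval) {x y : ℕ} (h1 : y ≠ x) (h2 : y ≠ x + 1) :
    forwardProb p x y = 0 := by
  simp [forwardProb, h1.symm, h2.symm]

lemma bitsMeasure_real_inter_countOnes (p : unitInterval) {m : ℕ} {s : Set (ℕ → Bool)} {x : ℕ}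
    (hs : ∀ b b' : ℕ → Bool, (∀ i < m, b i = b' i) → b ∈ s → b' ∈ s)
    (hx : ∀ b ∈ s, countOnes b m = x) (y : ℕ) :
    (bitsMeasure p).real (s ∩ {b | countOnes b (m + 1) = y}) =
      (bitsMeasure p).real s * forwardProb p x y := by
  rw [forwardProb, ← bitsMeasure_real_inter p hs]
  congr 1
  ext b
  simp only [Set.mem_inter_iff, Set.mem_ofPred_eq]
  refine and_congr_right fun hb => ?_
  rw [countOnes_succ, hx b hb]

/-- The binomial probabilities. -/
noncomputable def binomialProb (p : unitInterval) (n x : ℕ) : ℝ :=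
  n.choose x * (p : ℝ) ^ x * (1 - p) ^ (n - x)

lemma bitsMeasure_real_countOnes (p : unitInterval) (n x : ℕ) :
    (bitsMeasure p).real {b | countOnes b n = x} = binomialProb p n x := by
  induction n generalizing x with
  | zero =>
    rcases x with _ | x
    · simp [countOnes, binomialProb]
    · simp [countOnes, binomialProb]
  | succ n ih =>
    have key : ∀ z y, (bitsMeasure p).real ({b | countOnes b n = z} ∩ {b | countOnes b (n + 1) = y})
        = binomialProb p n z * forwardProb p z y := fun z y => by
      rw [bitsMeasure_real_inter_countOnes p (s := {b | countOnes b n = z}) _ (fun b hb => hb), ih]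
      exact fun b b' h hb => (countOnes_congr h).symm.trans hb
    have hms : ∀ n z, MeasurableSet {b : ℕ → Bool | countOnes b n = z} := fun n z =>
      measurable_countOnes n (measurableSet_singleton z)
    rcases x with _ | x
    · have : {b : ℕ → Bool | countOnes b (n + 1) = 0} =
          {b | countOnes b n = 0} ∩ {b | countOnes b (n + 1) = 0} := by
        ext b; simp only [Set.mem_inter_iff, Set.mem_ofPred_eq, countOnes_succ]; omega
      rw [this, key, forwardProb_self]
      simp [binomialProb, pow_succ]
    · have : {b : ℕ → Bool | countOnes b (n + 1) = x + 1} =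
          ({b | countOnes b n = x} ∩ {b | countOnes b (n + 1) = x + 1}) ∪
          ({b | countOnes b n = x + 1} ∩ {b | countOnes b (n + 1) = x + 1}) := by
        ext b
        simp only [Set.mem_inter_iff, Set.mem_ofPred_eq, countOnes_succ, Set.mem_union]
        have := Bool.toNat_le (b n); omega
      rw [this, measureReal_union _ ((hms _ _).inter (hms _ _)), key, key, forwardProb_self,
        forwardProb_succ]
      · simp only [binomialProb, Nat.choose_succ_succ', Nat.cast_add, Nat.add_sub_add_right]
        -- For `x ≥ n` the exponent `n - (x + 1)` is truncated, but its coefficient `n.choose (x +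
        -- 1)` vanishes.
        rcases lt_or_ge x n with h | h
        · rw [show n - x = (n - (x + 1)) + 1 by omega]; ring
        · rw [Nat.choose_eq_zero_of_lt (show n < x + 1 by omega)]; push_cast; ring
      · rw [Set.disjoint_left]
        rintro b ⟨h1, -⟩ ⟨h2, -⟩
        simp only [Set.mem_ofPred_eq] at h1 h2
        omega

/-- The probability of moving from `y` at level `-(n+1)` to `x` at level `-n`. -/
noncomputable def backwardProb (n y x : ℕ) : ℝ :=
  (rankMeasure n).real {i | pascalStep i y = x}

lemma backwardProb_self {n y : ℕ} (hy : y ≤ n + 1) :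
    backwardProb n y y = ((n + 1 : ℝ) - y) / (n + 1) := by
  have hset : {i : Fin (n + 1) | pascalStep i y = y} = ↑(Finset.univ.filter fun i : Fin (n + 1) => ¬ i.val < y) := by
    ext i
    simp only [pascalStep, Set.mem_ofPred_eq, Finset.coe_filter, Finset.mem_univ, true_and]
    split_ifs <;> omega
  have hc := Finset.card_filter_add_card_filter_not (s := (Finset.univ : Finset (Fin (n + 1)))) (fun i => i.val < y)
  have hc2 : (Finset.univ.filter fun i : Fin (n + 1) => i.val < y).card = y := by
    rw [Fin.card_filter_val_lt]; omega
  rw [hc2, Finset.card_univ, Fintype.card_fin] at hc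
  rw [backwardProb, rankMeasure_real, hset, Set.ncard_coe_finset]
  congr 1
  rw [eq_sub_iff_add_eq']
  exact_mod_cast hc

lemma backwardProb_pred {n x : ℕ} (hx : x ≤ n) :
    backwardProb n (x + 1) x = (x + 1 : ℝ) / (n + 1) := by
  have hset : {i : Fin (n + 1) | pascalStep i (x + 1) = x} =
      ↑(Finset.univ.filter fun i : Fin (n + 1) => i.val < x + 1) := by
    ext i
    simp only [pascalStep, Set.mem_ofPred_eq, Finset.coe_filter, Finset.mem_univ, true_and]
    split_ifs <;> omega
  rw [backwardProb, rankMeasure_real, hset, Set.ncard_coe_finset, Fin.card_filter_val_lt,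
    min_eq_right (by omega)]
  push_cast; rfl

lemma backwardProb_of_ne {n x y : ℕ} (h1 : y ≠ x) (h2 : y ≠ x + 1) : backwardProb n y x = 0 := by
  have hset : {i : Fin (n + 1) | pascalStep i y = x} = ∅ := by
    ext i
    simp only [pascalStep, Set.mem_ofPred_eq, Set.mem_empty_iff_false, iff_false]
    split_ifs <;> omega
  rw [backwardProb, hset, measureReal_empty]

/-- Bayes' formula: both sides are the joint probability of two consecutive vertices. The powers of
`p` and `1 - p` match, leaving identities between binomial coefficients free of `p`. -/
lemma binomialProb_mul_forwardProb (p : unitInterval) (n x y : ℕ) :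
    binomialProb p n x * forwardProb p x y = backwardProb n y x * binomialProb p (n + 1) y := by
  have hn : (n + 1 : ℝ) ≠ 0 := by positivity
  by_cases h1 : y = x
  · subst h1
    rw [forwardProb_self]
    rcases le_or_gt y (n + 1) with h | h
    · rw [backwardProb_self h, binomialProb, binomialProb]
      have hc : (n.choose y : ℝ) * (n + 1) = (n + 1).choose y * ((n + 1 : ℝ) - y) := by
        have := Nat.choose_mul_succ_eq n y
        rw [← Nat.cast_add_one, ← Nat.cast_sub h]
        exact_mod_cast this
      rcases h.eq_or_lt with rfl | h'
      · simp
      · rw [show n + 1 - y = (n - y) + 1 by omega]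
        field_simp
        rw [pow_succ]
        linear_combination (p : ℝ) ^ y * (1 - p) ^ (n - y) * (1 - p) * hc
    · simp [binomialProb, Nat.choose_eq_zero_of_lt h,
        Nat.choose_eq_zero_of_lt (Nat.lt_of_succ_lt h)]
  by_cases h2 : y = x + 1
  · subst h2
    rw [forwardProb_succ]
    rcases le_or_gt x n with h | h
    · rw [backwardProb_pred h, binomialProb, binomialProb]
      have hc : (n + 1 : ℝ) * n.choose x = (n + 1).choose (x + 1) * (x + 1) := by
        exact_mod_cast Nat.add_one_mul_choose_eq n x
      rw [Nat.add_sub_add_right]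
      field_simp
      rw [pow_succ]
      linear_combination (p : ℝ) ^ x * (1 - p) ^ (n - x) * p * hc
    · simp [binomialProb, Nat.choose_eq_zero_of_lt h,
        Nat.choose_eq_zero_of_lt (Nat.succ_lt_succ h)]
  rw [forwardProb_of_ne p h1 h2, backwardProb_of_ne h1 h2]
  simp

/-- Applying Bayes' formula at each step rewrites the law of the walk as a binomial start at level
`-m` followed by backward moves. -/
lemma bitsMeasure_real_forall_countOnes (p : unitInterval) (m : ℕ) (v : ℕ → ℕ) :
    (bitsMeasure p).real {b | ∀ j ≤ m, countOnes b j = v j} =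
      binomialProb p m (v m) * ∏ j ∈ Finset.range m, backwardProb j (v (j + 1)) (v j) := by
  induction m with
  | zero => simp [← bitsMeasure_real_countOnes]
  | succ m ih =>
    have hset : {b : ℕ → Bool | ∀ j ≤ m + 1, countOnes b j = v j} =
        {b | ∀ j ≤ m, countOnes b j = v j} ∩ {b | countOnes b (m + 1) = v (m + 1)} := by
      ext b
      simp only [Set.mem_ofPred_eq, Set.mem_inter_iff]
      refine ⟨fun h => ⟨fun j hj => h j (by omega), h _ le_rfl⟩, fun h j hj => ?_⟩
      rcases hj.eq_or_lt with rfl | h'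
      · exact h.2
      · exact h.1 j (by omega)
    rw [hset, bitsMeasure_real_inter_countOnes p (x := v m)
      (s := {b | ∀ j ≤ m, countOnes b j = v j}) _ (fun b hb => hb m le_rfl), ih,
      Finset.prod_range_succ]
    · linear_combination (∏ j ∈ Finset.range m, backwardProb j (v (j + 1)) (v j)) *
        binomialProb_mul_forwardProb p m (v m) (v (m + 1))
    · intro b b' h hb j hj
      rw [← hb j hj]
      exact (countOnes_congr fun i hi => h i (by omega)).symm

/-- Independent bits together with independent uniform ranks. -/
noncomputable def jointMeasure (p : unitInterval) :
    Measure ((ℕ → Bool) × (∀ n : ℕ, Fin (n + 1))) :=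
  (bitsMeasure p).prod ranksMeasure

instance (p : unitInterval) : IsProbabilityMeasure (jointMeasure p) := by
  unfold jointMeasure; infer_instance

lemma jointMeasure_real_forall_descend (p : unitInterval) (m : ℕ) (v : ℕ → ℕ) :
    (jointMeasure p).real {ω | ∀ j ≤ m, descend ω.2 j (m - j) (countOnes ω.1 m) = v j} =
      binomialProb p m (v m) * ∏ j ∈ Finset.range m, backwardProb j (v (j + 1)) (v j) := by
  have hset : {ω : (ℕ → Bool) × (∀ n : ℕ, Fin (n + 1)) |
      ∀ j ≤ m, descend ω.2 j (m - j) (countOnes ω.1 m) = v j} =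
      {b | countOnes b m = v m} ×ˢ
        Set.pi (Finset.range m) (fun j => {i : Fin (j + 1) | pascalStep i (v (j + 1)) = v j}) := by
    ext ω
    simp [descend_eq_iff]
  rw [hset, jointMeasure, measureReal_prod_prod, bitsMeasure_real_countOnes]
  congr 1
  rw [measureReal_def, ranksMeasure, Measure.infinitePi_pi _ fun _ _ => (Set.toFinite _).measurableSet,
    ENNReal.toReal_prod]
  rfl

lemma measurable_joint_descend (n k : ℕ) {x : (ℕ → Bool) × (∀ n : ℕ, Fin (n + 1)) → ℕ}
    (hx : Measurable x) :
    Measurable fun ω : (ℕ → Bool) × (∀ n : ℕ, Fin (n + 1)) => descend ω.2 n k (x ω) :=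
  measurable_descend (Filtration.const ℕᵒᵈ inferInstance le_rfl)
    (fun n => (measurable_pi_apply n).comp measurable_snd) hx

lemma measurable_descend_countOnes (m : ℕ) :
    Measurable fun (ω : (ℕ → Bool) × (∀ n : ℕ, Fin (n + 1))) (j : Finset.Iic m) =>
      descend ω.2 j (m - j) (countOnes ω.1 m) :=
  measurable_pi_lambda _ fun _ => measurable_joint_descend _ _
    ((measurable_countOnes m).comp measurable_fst)

lemma map_descend_countOnes (p : unitInterval) (m : ℕ) :
    (jointMeasure p).map (fun ω (j : Finset.Iic m) => descend ω.2 j (m - j) (countOnes ω.1 m)) =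
      (bitsMeasure p).map fun b (j : Finset.Iic m) => countOnes b j := by
  refine Measure.ext_of_singleton fun c => ?_
  have h2 : Measurable fun (b : ℕ → Bool) (j : Finset.Iic m) => countOnes b j :=
    measurable_pi_lambda _ fun j => measurable_countOnes j
  rw [Measure.map_apply (measurable_descend_countOnes m) (measurableSet_singleton c),
    Measure.map_apply h2 (measurableSet_singleton c)]
  -- The default value 0 is harmless: both formulas involve `v` only up to `m`.
  let v (j : ℕ) : ℕ := if h : j ∈ Finset.Iic m then c ⟨j, h⟩ else 0
  have e1 : (fun (ω : (ℕ → Bool) × (∀ n : ℕ, Fin (n + 1))) (j : Finset.Iic m) =>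
      descend ω.2 j (m - j) (countOnes ω.1 m)) ⁻¹' {c} =
      {ω | ∀ j ≤ m, descend ω.2 j (m - j) (countOnes ω.1 m) = v j} := by
    ext ω
    simp only [Set.mem_preimage, Set.mem_singleton_iff, funext_iff, Subtype.forall,
      Finset.mem_Iic, Set.mem_ofPred_eq]
    exact forall₂_congr fun j hj => by simp [v, hj]
  have e2 : (fun (b : ℕ → Bool) (j : Finset.Iic m) => countOnes b j) ⁻¹' {c} =
      {b | ∀ j ≤ m, countOnes b j = v j} := by
    ext ω
    simp only [Set.mem_preimage, Set.mem_singleton_iff, funext_iff, Subtype.forall,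
      Finset.mem_Iic, Set.mem_ofPred_eq]
    exact forall₂_congr fun j hj => by simp [v, hj]
  rw [e1, e2, ← measureReal_eq_measureReal_iff, jointMeasure_real_forall_descend,
    bitsMeasure_real_forall_countOnes]

end Law

open scoped ENNReal

/-! ### Contraction of the mean distance in one backward step -/

section Contraction

/-- Exactly `z` of the `n + 1` ranks lie below `z`, and each of these lowers the vertex by 1: the
total is `(n + 1) z - z`. -/
lemma sum_pascalStep {n z : ℕ} (hz : z ≤ n + 1) :
    ∑ i : Fin (n + 1), pascalStep i z = n * z := by
  have h1 : ∑ i : Fin (n + 1), (pascalStep i z + if i.val < z then 1 else 0) = (n + 1) * z := by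
    rw [Finset.sum_congr rfl (g := fun _ => z)]
    · simp
    · intro i _
      unfold pascalStep; split_ifs <;> omega
  rw [Finset.sum_add_distrib, Finset.sum_boole, Fin.card_filter_val_lt, min_eq_right hz] at h1
  rw [add_mul, one_mul] at h1
  simpa using h1

/-- A common rank preserves order, so the sum of distances is the difference of the two sums. -/
lemma sum_dist_pascalStep {n z z' : ℕ} (hz : z ≤ n + 1) (hz' : z' ≤ n + 1) :
    ∑ i : Fin (n + 1), Nat.dist (pascalStep i z) (pascalStep i z') = n * Nat.dist z z' := by
  wlog h : z ≤ z' generalizing z z'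
  · rw [Nat.dist_comm z z', ← this hz' hz (le_of_not_ge h)]
    exact Finset.sum_congr rfl fun i _ => Nat.dist_comm _ _
  have h1 : ∑ i : Fin (n + 1), Nat.dist (pascalStep i z) (pascalStep i z') +
      ∑ i : Fin (n + 1), pascalStep i z = ∑ i : Fin (n + 1), pascalStep i z' := by
    rw [← Finset.sum_add_distrib]
    refine Finset.sum_congr rfl fun i _ => ?_
    have := pascalStep_mono i h
    rw [Nat.dist_eq_sub_of_le this]; omega
  rw [sum_pascalStep hz, sum_pascalStep hz'] at h1
  rw [Nat.dist_eq_sub_of_le h, Nat.mul_sub]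
  omega

/-- The rank is independent of the pair `(Z, Z')`, so Fubini reduces the claim to the average over
ranks for fixed vertices. The products avoid division in `ℝ≥0∞`. -/
lemma lintegral_dist_pascalStep {Ω : Type*} {m mΩ : MeasurableSpace Ω} {P : Measure Ω}
    [IsProbabilityMeasure P] (hm : m ≤ mΩ) {n : ℕ} {U : Ω → Fin (n + 1)} (hU : Measurable U)
    (hlaw : P.map U = rankMeasure n) (hind : Indep (MeasurableSpace.comap U inferInstance) m P)
    {Z Z' : Ω → ℕ} (hZ : Measurable[m] Z) (hZ' : Measurable[m] Z')
    (hle : ∀ ω, Z ω ≤ n + 1) (hle' : ∀ ω, Z' ω ≤ n + 1) :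
    ((n + 1 : ℕ) : ℝ≥0∞) *
      ∫⁻ ω, (Nat.dist (pascalStep (U ω) (Z ω)) (pascalStep (U ω) (Z' ω)) : ℝ≥0∞) ∂P =
      n * ∫⁻ ω, (Nat.dist (Z ω) (Z' ω) : ℝ≥0∞) ∂P := by
  have hZZ : Measurable[m] fun ω => (Z ω, Z' ω) := hZ.prodMk hZ'
  have hZZ' : Measurable fun ω => (Z ω, Z' ω) := hZZ.mono hm le_rfl
  have hI : IndepFun (fun ω => (Z ω, Z' ω)) U P :=
    indep_of_indep_of_le_left hind.symm hZZ.comap_le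
  have hmap := (indepFun_iff_map_prod_eq_prod_map_map hZZ'.aemeasurable hU.aemeasurable).mp hI
  let f : (ℕ × ℕ) × Fin (n + 1) → ℝ≥0∞ := fun q =>
    (Nat.dist (pascalStep q.2 q.1.1) (pascalStep q.2 q.1.2) : ℝ≥0∞)
  have hf : Measurable f := measurable_of_countable f
  have h1 : ∫⁻ ω, (Nat.dist (pascalStep (U ω) (Z ω)) (pascalStep (U ω) (Z' ω)) : ℝ≥0∞) ∂P =
      ∫⁻ ω, ∫⁻ i, f ((Z ω, Z' ω), i) ∂(rankMeasure n) ∂P := by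
    rw [← hlaw, ← lintegral_map (f := fun z => ∫⁻ i, f (z, i) ∂(P.map U))
      (measurable_of_countable _) hZZ', ← lintegral_prod _ hf.aemeasurable, ← hmap,
      lintegral_map hf (hZZ'.prodMk hU)]
  have h2 : ∀ z z', z ≤ n + 1 → z' ≤ n + 1 → ((n + 1 : ℕ) : ℝ≥0∞) *
      ∫⁻ i, f ((z, z'), i) ∂(rankMeasure n) = n * (Nat.dist z z' : ℝ≥0∞) := by
    intro z z' hz hz'
    have hs : ∀ i : Fin (n + 1), rankMeasure n {i} = ((n + 1 : ℕ) : ℝ≥0∞)⁻¹ := fun i => by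
      rw [rankMeasure, PMF.toMeasure_apply_singleton _ _ (measurableSet_singleton i)]
      simp
    simp only [lintegral_fintype, hs, ← Finset.sum_mul, f]
    rw [mul_comm, mul_assoc, ENNReal.inv_mul_cancel (by simp) (by simp), mul_one]
    exact_mod_cast sum_dist_pascalStep hz hz'
  have hg : Measurable fun ω => ∫⁻ i, f ((Z ω, Z' ω), i) ∂(rankMeasure n) :=
    (measurable_of_countable fun z => ∫⁻ i, f (z, i) ∂(rankMeasure n)).comp hZZ'
  rw [h1, ← lintegral_const_mul _ hg, ← lintegral_const_mul]
  · exact lintegral_congr fun ω => h2 _ _ (hle ω) (hle' ω)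
  · exact (measurable_of_countable fun z : ℕ × ℕ => (Nat.dist z.1 z.2 : ℝ≥0∞)).comp hZZ'

end Contraction

/-! ### Coupled descents on the space of bits and ranks -/

section Joint

lemma indepFun_snd_prodMk {Ω Ω' α β : Type*} [MeasurableSpace Ω] [MeasurableSpace Ω']
    [MeasurableSpace α] [MeasurableSpace β] {μ : Measure Ω} [IsProbabilityMeasure μ]
    {ν : Measure Ω'} [IsProbabilityMeasure ν] {f : Ω' → α} {g : Ω' → β} (hf : Measurable f)
    (hg : Measurable g) (h : IndepFun f g ν) :
    IndepFun (fun ω : Ω × Ω' => f ω.2) (fun ω => (ω.1, g ω.2)) (μ.prod ν) := by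
  rw [indepFun_iff_measure_inter_preimage_eq_mul]
  intro s t hs ht
  have hf' : Measurable fun ω : Ω × Ω' => f ω.2 := hf.comp measurable_snd
  have hg' : Measurable fun ω : Ω × Ω' => (ω.1, g ω.2) :=
    measurable_fst.prodMk (hg.comp measurable_snd)
  rw [Measure.prod_apply ((hf' hs).inter (hg' ht)), Measure.prod_apply (hg' ht),
    ← lintegral_const_mul _ (measurable_measure_prodMk_left (hg' ht))]
  refine lintegral_congr fun x => ?_
  have h1 : (μ.prod ν) ((fun ω : Ω × Ω' => f ω.2) ⁻¹' s) = ν (f ⁻¹' s) := by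
    rw [show (fun ω : Ω × Ω' => f ω.2) ⁻¹' s = Set.univ ×ˢ (f ⁻¹' s) by ext; simp,
      Measure.prod_prod]
    simp
  rw [h1]
  exact indepFun_iff_measure_inter_preimage_eq_mul.mp h s (Prod.mk x ⁻¹' t) hs
    (measurable_prodMk_left ht)

/-- The `n`-th rank. -/
def jointRank (n : ℕ) (ω : (ℕ → Bool) × (∀ n : ℕ, Fin (n + 1))) : Fin (n + 1) := ω.2 n

lemma measurable_jointRank (n : ℕ) : Measurable (jointRank n) :=
  (measurable_pi_apply n).comp measurable_snd

lemma measurable_fst_prodMk_jointRank (n : ℕ) :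
    Measurable fun ω : (ℕ → Bool) × (∀ n : ℕ, Fin (n + 1)) => (ω.1, jointRank n ω) :=
  measurable_fst.prodMk (measurable_jointRank n)

/-- The filtration of the ranks, enlarged with all the bits. -/
def jointFiltration : Filtration ℕᵒᵈ
    (inferInstance : MeasurableSpace ((ℕ → Bool) × (∀ n : ℕ, Fin (n + 1)))) :=
  pastFiltration (fun n ω => (ω.1, jointRank n ω)) measurable_fst_prodMk_jointRank

/-- The filtration of the ranks. -/
def rankFiltration : Filtration ℕᵒᵈ
    (inferInstance : MeasurableSpace ((ℕ → Bool) × (∀ n : ℕ, Fin (n + 1)))) :=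
  pastFiltration jointRank measurable_jointRank

lemma measurable_jointRank_rankFiltration (n : ℕ) :
    Measurable[rankFiltration (toDual n)] (jointRank n) :=
  measurable_pastFiltration _ measurable_jointRank le_rfl

lemma measurable_jointRank_jointFiltration (n : ℕ) :
    Measurable[jointFiltration (toDual n)] (jointRank n) :=
  measurable_snd.comp (measurable_pastFiltration _ measurable_fst_prodMk_jointRank le_rfl)

lemma measurable_fst_jointFiltration (n : ℕ) :
    Measurable[jointFiltration (toDual n)]
      (Prod.fst : (ℕ → Bool) × (∀ n : ℕ, Fin (n + 1)) → (ℕ → Bool)) :=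
  Measurable.comp (g := fun q : (ℕ → Bool) × Fin (n + 1) => q.1) measurable_fst
    (measurable_pastFiltration _ measurable_fst_prodMk_jointRank le_rfl)

lemma rankFiltration_le (n : ℕ) : rankFiltration (toDual n) ≤ jointFiltration (toDual n) :=
  pastFiltration_le_of_measurable _ _ _ fun j hj =>
    (measurable_jointRank_jointFiltration j).mono
      (jointFiltration.mono (toDual_le_toDual.mpr hj)) le_rfl

lemma iIndepFun_eval_ranksMeasure :
    iIndepFun (fun n (u : ∀ n : ℕ, Fin (n + 1)) => u n) ranksMeasure :=
  iIndepFun_infinitePi (X := fun _ x => x) fun _ => measurable_id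

lemma map_jointRank (p : unitInterval) (n : ℕ) :
    (jointMeasure p).map (jointRank n) = rankMeasure n := by
  rw [← Measure.infinitePi_map_eval rankMeasure n, ← ranksMeasure]
  conv_rhs => rw [← Measure.snd_prod (μ := bitsMeasure p) (ν := ranksMeasure), Measure.snd,
    Measure.map_map (measurable_pi_apply n) measurable_snd]
  rfl

lemma indep_jointRank (p : unitInterval) (n : ℕ) :
    Indep (MeasurableSpace.comap (jointRank n) inferInstance)
      (jointFiltration (toDual (n + 1))) (jointMeasure p) := by
  have h1 : IndepFun (fun u : ∀ n : ℕ, Fin (n + 1) => u n)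
      (fun u (j : Set.Ioi n) => u j) ranksMeasure := by
    have := indep_iSup_of_disjoint (fun j => (measurable_pi_apply j).comap_le)
      (iIndepFun_eval_ranksMeasure).iIndep (S := {n}) (T := Set.Ioi n) (by simp)
    refine indep_of_indep_of_le_left (indep_of_indep_of_le_right this ?_) ?_
    · rw [MeasurableSpace.pi, MeasurableSpace.comap_iSup]
      refine iSup_le fun j => ?_
      rw [MeasurableSpace.comap_comp]
      exact (le_iSup₂_of_le (f := fun (j : ℕ) (_ : j ∈ Set.Ioi n) =>
        MeasurableSpace.comap (fun u : ∀ n : ℕ, Fin (n + 1) => u j) inferInstance) j.1 j.2 le_rfl)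
    · simp
  have h2 := indepFun_snd_prodMk (μ := bitsMeasure p) (measurable_pi_apply n)
    (measurable_pi_lambda _ fun j : Set.Ioi n => measurable_pi_apply j.1) h1
  refine indep_of_indep_of_le_right h2 (pastFiltration_le_of_measurable _ _ _ fun j hj => ?_)
  have h3 : Measurable fun q : (ℕ → Bool) × (∀ j : Set.Ioi n, Fin (j + 1)) =>
      (q.1, q.2 ⟨j, hj⟩) :=
    measurable_fst.prodMk ((measurable_pi_apply _).comp measurable_snd)
  exact h3.comp (comap_measurable _)

lemma ENNReal.mul_le_mul_of_mul_eq {a b c x y z : ℝ≥0∞} (ha : a ≠ 0) (ha' : a ≠ ∞)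
    (h1 : b * y ≤ a * z) (h2 : a * x = c * y) : b * x ≤ c * z := by
  rw [← ENNReal.mul_le_mul_iff_right ha ha', mul_left_comm, h2, mul_left_comm, mul_left_comm a]
  exact mul_le_mul_right h1 c

/-- The one-step factors `j/(j+1)` telescope to `n/(n+k)`. The starting points may depend on the
bits, hence the enlarged filtration. -/
lemma lintegral_dist_descend_le (p : unitInterval) {n k : ℕ}
    {X X' : (ℕ → Bool) × (∀ n : ℕ, Fin (n + 1)) → ℕ}
    (hX : Measurable[jointFiltration (toDual (n + k))] X)
    (hX' : Measurable[jointFiltration (toDual (n + k))] X')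
    (hle : ∀ ω, X ω ≤ n + k) (hle' : ∀ ω, X' ω ≤ n + k) :
    ((n + k : ℕ) : ℝ≥0∞) * ∫⁻ ω, (Nat.dist (descend ω.2 n k (X ω)) (descend ω.2 n k (X' ω)) : ℝ≥0∞)
      ∂(jointMeasure p) ≤ n * ∫⁻ ω, (Nat.dist (X ω) (X' ω) : ℝ≥0∞) ∂(jointMeasure p) := by
  induction k generalizing n with
  | zero => exact le_rfl
  | succ k ih =>
    rw [show n + (k + 1) = n + 1 + k by omega] at hX hX'
    have hle1 : ∀ ω, X ω ≤ n + 1 + k := fun ω => (hle ω).trans (by omega)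
    have hle1' : ∀ ω, X' ω ≤ n + 1 + k := fun ω => (hle' ω).trans (by omega)
    have h1 := ih hX hX' hle1 hle1'
    have h2 := lintegral_dist_pascalStep (jointFiltration.le (toDual (n + 1)))
      (measurable_jointRank n) (map_jointRank p n) (indep_jointRank p n)
      (measurable_descend jointFiltration measurable_jointRank_jointFiltration hX)
      (measurable_descend jointFiltration measurable_jointRank_jointFiltration hX')
      (fun ω => descend_le _ (hle1 ω)) (fun ω => descend_le _ (hle1' ω))
    rw [show n + (k + 1) = n + 1 + k by omega]
    exact ENNReal.mul_le_mul_of_mul_eq (by simp) (by simp) h1 h2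

lemma lintegral_descend_countOnes (p : unitInterval) {j m : ℕ} (hj : j ≤ m) (f : ℕ → ℝ≥0∞) :
    ∫⁻ ω, f (descend ω.2 j (m - j) (countOnes ω.1 m)) ∂(jointMeasure p) =
      ∫⁻ b, f (countOnes b j) ∂(bitsMeasure p) := by
  have h := congrArg (fun μ => ∫⁻ c, f (c ⟨j, Finset.mem_Iic.mpr hj⟩) ∂μ)
    (map_descend_countOnes p m)
  have hf : Measurable fun c : Finset.Iic m → ℕ => f (c ⟨j, Finset.mem_Iic.mpr hj⟩) :=
    (measurable_of_countable f).comp (measurable_pi_apply _)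
  beta_reduce at h
  rwa [lintegral_map hf (measurable_descend_countOnes m),
    lintegral_map hf (measurable_pi_lambda _ fun j => measurable_countOnes j)] at h

/-- Markov's inequality, as distinct integers are at distance at least 1. The descent from level
`-M` passes through level `-m` with the law of the walk there, so the bound does not depend on `M`.
-/
lemma measure_descend_ne_le (p : unitInterval) {n m M x : ℕ} (hnm : n ≤ m) (hmM : m ≤ M)
    (hx : x ≤ m) :
    (m : ℝ≥0∞) * jointMeasure p {ω | descend ω.2 n (M - n) (countOnes ω.1 M) ≠
      descend ω.2 n (m - n) x} ≤ n * ∫⁻ b, (Nat.dist (countOnes b m) x : ℝ≥0∞) ∂(bitsMeasure p) := by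
  have h1 := lintegral_dist_descend_le p (n := n) (k := m - n)
    (X := fun ω => descend ω.2 m (M - m) (countOnes ω.1 M)) (X' := fun _ => x)
    (by
      rw [Nat.add_sub_cancel' hnm]
      refine measurable_descend jointFiltration measurable_jointRank_jointFiltration ?_
      exact (measurable_countOnes M).comp (measurable_fst_jointFiltration _))
    measurable_const
    (fun ω => by
      rw [Nat.add_sub_cancel' hnm]
      refine descend_le _ ?_
      have := countOnes_lt ω.1 M; omega)
    (fun _ => by omega)
  rw [lintegral_descend_countOnes p hmM (fun y => (Nat.dist y x : ℝ≥0∞)),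
    Nat.add_sub_cancel' hnm] at h1
  refine le_trans (mul_le_mul_right ?_ _) h1
  have hmeas : MeasurableSet {ω : (ℕ → Bool) × (∀ n : ℕ, Fin (n + 1)) |
      descend ω.2 n (M - n) (countOnes ω.1 M) ≠ descend ω.2 n (m - n) x} :=
    (measurableSet_eq_fun (measurable_joint_descend _ _
      ((measurable_countOnes M).comp measurable_fst))
      (measurable_joint_descend _ _ measurable_const)).compl
  rw [← lintegral_indicator_one hmeas]
  refine lintegral_mono fun ω => ?_
  by_cases hω : ω ∈ {ω : (ℕ → Bool) × (∀ n : ℕ, Fin (n + 1)) |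
      descend ω.2 n (M - n) (countOnes ω.1 M) ≠ descend ω.2 n (m - n) x}
  swap
  · rw [Set.indicator_of_notMem hω]; exact zero_le
  rw [Set.indicator_of_mem hω, Pi.one_apply]
  have e : descend ω.2 n (M - n) (countOnes ω.1 M) =
      descend ω.2 n (m - n) (descend ω.2 m (M - m) (countOnes ω.1 M)) := by
    have := descend_add ω.2 n (m - n) (M - m) (countOnes ω.1 M)
    rwa [Nat.add_sub_cancel' hnm, show m - n + (M - m) = M - n by omega] at this
  rw [Set.mem_ofPred_eq, e] at hω
  exact Nat.one_le_cast.mpr (Nat.pos_of_ne_zero fun h => hω (Nat.eq_of_dist_eq_zero h))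

end Joint

/-! ### Law of large numbers and almost sure coalescence -/

section LawOfLargeNumbers

open Filter Topology

lemma tendsto_eLpNorm_countOnes (p : unitInterval) :
    Tendsto (fun n : ℕ => ∫⁻ b, ‖(n : ℝ)⁻¹ * countOnes b n - p‖ₑ ∂(bitsMeasure p)) atTop (𝓝 0) := by
  let X (i : ℕ) (b : ℕ → Bool) : ℝ := (b i).toNat
  have hm : ∀ i, Measurable (X i) := fun i =>
    (measurable_of_countable fun c : Bool => (c.toNat : ℝ)).comp (measurable_pi_apply i)
  have hmap : ∀ i, (bitsMeasure p).map (fun b => b i) = bernoulliMeasure true false p := fun i =>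
    Measure.infinitePi_map_eval (fun _ : ℕ => bernoulliMeasure true false p) i
  have hi : iIndepFun X (bitsMeasure p) :=
    iIndepFun_infinitePi (X := fun _ (c : Bool) => (c.toNat : ℝ)) fun _ => measurable_of_countable _
  have hid : ∀ i, IdentDistrib (X i) (X 0) (bitsMeasure p) (bitsMeasure p) := fun i =>
    IdentDistrib.comp (u := fun c : Bool => (c.toNat : ℝ)) (f := fun b : ℕ → Bool => b i)
      (g := fun b : ℕ → Bool => b 0)
      ⟨(measurable_pi_apply i).aemeasurable, (measurable_pi_apply 0).aemeasurable,
        (hmap i).trans (hmap 0).symm⟩ (measurable_of_countable _)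
  have hL : MemLp (X 0) 1 (bitsMeasure p) := by
    refine MemLp.of_bound (hm 0).aestronglyMeasurable 1 (Eventually.of_forall fun b => ?_)
    simp only [X]
    cases b 0 <;> simp
  have hE : ∫ b, X 0 b ∂(bitsMeasure p) = p := by
    have := integral_map (μ := bitsMeasure p) (φ := fun b : ℕ → Bool => b 0)
      (f := fun c : Bool => (c.toNat : ℝ)) (measurable_pi_apply 0).aemeasurable
      (measurable_of_countable _).aestronglyMeasurable
    rw [hmap, integral_bernoulliMeasure] at this
    simpa using this.symm
  have h := strong_law_Lp le_rfl (by simp) X hL (fun i j hij => hi.indepFun hij) hid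
  refine h.congr fun n => ?_
  rw [eLpNorm_one_eq_lintegral_enorm]
  refine lintegral_congr fun b => ?_
  rw [hE, smul_eq_mul, countOnes]
  push_cast
  rfl

/-- Replacing `p m` by its integer part costs at most 1. -/
lemma lintegral_dist_countOnes_le (p : unitInterval) (m : ℕ) :
    ∫⁻ b, (Nat.dist (countOnes b m) ⌊(p : ℝ) * m⌋₊ : ℝ≥0∞) ∂(bitsMeasure p) ≤
      m * ∫⁻ b, ‖(m : ℝ)⁻¹ * countOnes b m - p‖ₑ ∂(bitsMeasure p) + 1 := by
  have hpm : 0 ≤ (p : ℝ) * m := mul_nonneg p.2.1 (by positivity)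
  have hmeas : Measurable fun b => ‖(m : ℝ)⁻¹ * countOnes b m - p‖ₑ :=
    (measurable_of_countable fun c : ℕ => ‖(m : ℝ)⁻¹ * c - p‖ₑ).comp (measurable_countOnes m)
  rw [← lintegral_const_mul _ hmeas]
  have h1 : (1 : ℝ≥0∞) = ∫⁻ _, 1 ∂(bitsMeasure p) := by simp
  rw [h1, ← lintegral_add_right _ measurable_const]
  refine lintegral_mono fun b => ?_
  rcases Nat.eq_zero_or_pos m with rfl | hm
  · simp [countOnes]
  have hm' : (0 : ℝ) < m := by exact_mod_cast hm
  have e1 : ((Nat.dist (countOnes b m) ⌊(p : ℝ) * m⌋₊ : ℕ) : ℝ≥0∞) =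
      ENNReal.ofReal |(countOnes b m : ℝ) - ⌊(p : ℝ) * m⌋₊| := by
    rw [← ENNReal.ofReal_natCast]
    congr 1
    rcases le_total (countOnes b m) ⌊(p : ℝ) * m⌋₊ with h | h
    · rw [Nat.dist_eq_sub_of_le h, Nat.cast_sub h, abs_of_nonpos, neg_sub]
      exact sub_nonpos.mpr (by exact_mod_cast h)
    · rw [Nat.dist_eq_sub_of_le_right h, Nat.cast_sub h, abs_of_nonneg]
      exact sub_nonneg.mpr (by exact_mod_cast h)
  have e2 : (m : ℝ≥0∞) * ‖(m : ℝ)⁻¹ * countOnes b m - p‖ₑ + 1 =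
      ENNReal.ofReal (m * |(m : ℝ)⁻¹ * countOnes b m - p| + 1) := by
    rw [ENNReal.ofReal_add (by positivity) zero_le_one, ENNReal.ofReal_mul (by positivity),
      ENNReal.ofReal_natCast, ENNReal.ofReal_one, ← ofReal_norm, Real.norm_eq_abs]
  rw [e1, e2]
  refine ENNReal.ofReal_le_ofReal ?_
  have e3 : (m : ℝ) * |(m : ℝ)⁻¹ * countOnes b m - p| = |(countOnes b m : ℝ) - p * m| := by
    rw [← abs_of_pos hm', ← abs_mul, abs_of_pos hm']
    congr 1
    field_simp
  rw [e3]
  have h2 := Nat.floor_le hpm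
  have h3 := Nat.lt_floor_add_one ((p : ℝ) * m)
  have h4 : |(p : ℝ) * m - ⌊(p : ℝ) * m⌋₊| ≤ 1 := by
    rw [abs_le]; constructor <;> linarith
  have h5 := abs_sub_le (countOnes b m : ℝ) ((p : ℝ) * m) ⌊(p : ℝ) * m⌋₊
  linarith

lemma exists_subseq_lintegral_dist_le (p : unitInterval) :
    ∃ φ : ℕ → ℕ, StrictMono φ ∧ ∀ k, 0 < φ k ∧
      ∫⁻ b, (Nat.dist (countOnes b (φ k)) ⌊(p : ℝ) * φ k⌋₊ : ℝ≥0∞) ∂(bitsMeasure p) ≤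
        φ k * 2⁻¹ ^ k := by
  refine extraction_forall_of_eventually (P := fun k m => 0 < m ∧
    ∫⁻ b, (Nat.dist (countOnes b m) ⌊(p : ℝ) * m⌋₊ : ℝ≥0∞) ∂(bitsMeasure p) ≤ m * 2⁻¹ ^ k)
    fun k => ?_
  have h1 : Tendsto (fun n : ℕ => ∫⁻ b, ‖(n : ℝ)⁻¹ * countOnes b n - p‖ₑ ∂(bitsMeasure p) +
      (n : ℝ≥0∞)⁻¹) atTop (𝓝 0) := by
    simpa using (tendsto_eLpNorm_countOnes p).add ENNReal.tendsto_inv_nat_nhds_zero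
  have h2 : (0 : ℝ≥0∞) < 2⁻¹ ^ k := ENNReal.pow_pos (by simp) k
  filter_upwards [h1.eventually (gt_mem_nhds h2), eventually_gt_atTop 0] with m hm hm0
  refine ⟨hm0, (lintegral_dist_countOnes_le p m).trans ?_⟩
  refine le_trans (le_of_eq ?_) (mul_le_mul_right hm.le (m : ℝ≥0∞))
  rw [mul_add, ENNReal.mul_inv_cancel (by exact_mod_cast hm0.ne') (by simp)]

/-- Borel–Cantelli: the probabilities of disagreement are at most `n 2⁻ᵏ`. The level `M k` is left
free so as to be taken equal to `φ k` and to `φ (k + 1)`. -/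
lemma ae_eventually_descend_eq (p : unitInterval) {φ M : ℕ → ℕ} (hφ : StrictMono φ)
    (hφ0 : ∀ k, 0 < φ k)
    (hint : ∀ k, ∫⁻ b, (Nat.dist (countOnes b (φ k)) ⌊(p : ℝ) * φ k⌋₊ : ℝ≥0∞) ∂(bitsMeasure p) ≤
        φ k * 2⁻¹ ^ k) (hM : ∀ k, φ k ≤ M k) (n : ℕ) :
    ∀ᵐ ω ∂(jointMeasure p), ∀ᶠ k in atTop, descend ω.2 n (M k - n) (countOnes ω.1 (M k)) =
      descend ω.2 n (φ k - n) ⌊(p : ℝ) * φ k⌋₊ := by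
  -- Shifting the index by `n` ensures `n ≤ φ (k + n)`, so that every descent starts beyond level
  -- `-n`.
  have hle : ∀ k, jointMeasure p {ω | descend ω.2 n (M (k + n) - n) (countOnes ω.1 (M (k + n))) ≠
      descend ω.2 n (φ (k + n) - n) ⌊(p : ℝ) * φ (k + n)⌋₊} ≤ n * 2⁻¹ ^ k := by
    intro k
    have hn : n ≤ φ (k + n) := (Nat.le_add_left n k).trans (hφ.id_le _)
    have hfl : ⌊(p : ℝ) * φ (k + n)⌋₊ ≤ φ (k + n) :=
      Nat.floor_le_of_le (mul_le_of_le_one_left (by positivity) p.2.2)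
    have h1 := measure_descend_ne_le p hn (hM (k + n)) hfl
    have h2 : ((φ (k + n) : ℕ) : ℝ≥0∞) ≠ 0 := by exact_mod_cast (hφ0 _).ne'
    rw [← ENNReal.mul_le_mul_iff_right h2 (by simp)]
    refine h1.trans ((mul_le_mul_right (hint _) _).trans ?_)
    rw [mul_left_comm]
    refine mul_le_mul_right (mul_le_mul_right ?_ _) _
    exact pow_le_pow_of_le_one (by simp) (by simp) (Nat.le_add_right k n)
  have hsum : ∑' k, jointMeasure p
      {ω | descend ω.2 n (M (k + n) - n) (countOnes ω.1 (M (k + n))) ≠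
      descend ω.2 n (φ (k + n) - n) ⌊(p : ℝ) * φ (k + n)⌋₊} ≠ ∞ := by
    refine ne_top_of_le_ne_top ?_ (ENNReal.tsum_le_tsum hle)
    rw [ENNReal.tsum_mul_left, ENNReal.tsum_geometric]
    refine ENNReal.mul_ne_top (by simp) ?_
    simp
  filter_upwards [ae_eventually_notMem hsum] with ω hω
  rw [← map_add_atTop_eq_nat n, eventually_map]
  filter_upwards [hω] with k hk
  exact not_not.mp hk

end LawOfLargeNumbers

/-! ### The walk as a limit of descents, measurable in the ranks -/

section LimitVertex

open Filter Topology

/-- The vertex at level `-n` obtained in the limit by starting the descent from the vertices `x k`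
at the levels `-φ k`. -/
noncomputable def limitVertex (φ x : ℕ → ℕ) (n : ℕ)
    (ω : (ℕ → Bool) × (∀ n : ℕ, Fin (n + 1))) : PascalVertex n :=
  ⟨min n (limsup (fun k => descend ω.2 n (φ k - n) (x k)) atTop), by omega⟩

/-- The starting vertices are deterministic, so no bit enters. A limsup capped at `n` is measurable
and a vertex everywhere, even where the descents do not stabilize. -/
lemma measurable_limitVertex (φ x : ℕ → ℕ) (n : ℕ) :
    Measurable[rankFiltration (toDual n)] (limitVertex φ x n) := by
  have h1 : ∀ k, Measurable[rankFiltration (toDual n)]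
      fun ω : (ℕ → Bool) × (∀ n : ℕ, Fin (n + 1)) => descend ω.2 n (φ k - n) (x k) := fun k =>
    measurable_descend rankFiltration measurable_jointRank_rankFiltration measurable_const
  have h2 : Measurable[rankFiltration (toDual n)]
      fun ω : (ℕ → Bool) × (∀ n : ℕ, Fin (n + 1)) =>
        limsup (fun k => descend ω.2 n (φ k - n) (x k)) atTop := Measurable.limsup h1
  have h3 : Measurable fun y : ℕ => (⟨min n y, by omega⟩ : PascalVertex n) :=
    measurable_of_countable _
  exact h3.comp h2

lemma limitVertex_eq_of_eventually {φ x : ℕ → ℕ} {n c : ℕ}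
    {ω : (ℕ → Bool) × (∀ n : ℕ, Fin (n + 1))} (hc : c ≤ n)
    (h : ∀ᶠ k in atTop, descend ω.2 n (φ k - n) (x k) = c) : (limitVertex φ x n ω).val = c := by
  simp only [limitVertex]
  rw [limsup_congr h, limsup_const, min_eq_right hc]

/-- If the descents started from `x k` and `y k` at level `-φ k` eventually agree, and so do those
started from `y (k + 1)` and `x k`, then both eventually agree with the limit vertex. -/
lemma eventually_eq_limitVertex {φ x : ℕ → ℕ} (hφ : Filter.Tendsto φ atTop atTop) (hx : ∀ k, x k ≤ φ k) {n : ℕ}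
    {ω : (ℕ → Bool) × (∀ n : ℕ, Fin (n + 1))} {y : ℕ → ℕ}
    (h1 : ∀ᶠ k in atTop, y k = descend ω.2 n (φ k - n) (x k))
    (h2 : ∀ᶠ k in atTop, y (k + 1) = descend ω.2 n (φ k - n) (x k)) :
    (∀ᶠ k in atTop, descend ω.2 n (φ k - n) (x k) = limitVertex φ x n ω) ∧
      ∀ᶠ k in atTop, y k = limitVertex φ x n ω := by
  obtain ⟨N, hN⟩ := eventually_atTop.mp (h1.and (h2.and (hφ.eventually_ge_atTop n)))
  -- `y k` and `y (k + 1)` agree with the same descent, from `x k`, so `y` is eventually constant.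
  have hconst : ∀ k ≥ N, y k = y N := by
    intro k hk
    induction k, hk using Nat.le_induction with
    | base => rfl
    | succ k hk ih => rw [(hN k hk).2.1, ← (hN k hk).1, ih]
  have hW : ∀ᶠ k in atTop, descend ω.2 n (φ k - n) (x k) = y N :=
    eventually_atTop.mpr ⟨N, fun k hk => by rw [← (hN k hk).1, hconst k hk]⟩
  have hle : y N ≤ n := by
    rw [(hN N le_rfl).1]
    refine descend_le _ ((hx N).trans ?_)
    have := (hN N le_rfl).2.2
    omega
  rw [limitVertex_eq_of_eventually hle hW]
  exact ⟨hW, eventually_atTop.mpr ⟨N, hconst⟩⟩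

/-- Eventual equality makes indicators of events converge almost surely, hence their probabilities;
these are already constant once `φ k ≥ m`, by time reversal. -/
lemma map_restrict_eq_of_eventually (p : unitInterval) {φ : ℕ → ℕ} (hφ : StrictMono φ)
    {V : ∀ n : ℕ, (ℕ → Bool) × (∀ n : ℕ, Fin (n + 1)) → PascalVertex n}
    (hV : ∀ n, Measurable (V n))
    (h : ∀ᵐ ω ∂(jointMeasure p), ∀ n, ∀ᶠ k in atTop,
      descend ω.2 n (φ k - n) (countOnes ω.1 (φ k)) = V n ω) (m : ℕ) :
    (jointMeasure p).map (fun ω (j : Finset.Iic m) => (V j ω).val) =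
      (bitsMeasure p).map fun b (j : Finset.Iic m) => countOnes b j := by
  have hVm : Measurable fun ω (j : Finset.Iic m) => (V j ω).val :=
    measurable_pi_lambda _ fun j => (measurable_of_countable Fin.val).comp (hV j)
  have hC : ∀ m : ℕ, Measurable fun (b : ℕ → Bool) (j : Finset.Iic m) => countOnes b j := fun m =>
    measurable_pi_lambda _ fun j => measurable_countOnes j
  have hY : ∀ M, Measurable fun (ω : (ℕ → Bool) × (∀ n : ℕ, Fin (n + 1))) (j : Finset.Iic m) =>
      descend ω.2 j (M - j) (countOnes ω.1 M) := fun M =>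
    measurable_pi_lambda _ fun j => measurable_joint_descend _ _
      ((measurable_countOnes M).comp measurable_fst)
  have hlaw : ∀ M, m ≤ M → (jointMeasure p).map (fun ω (j : Finset.Iic m) =>
      descend ω.2 j (M - j) (countOnes ω.1 M)) =
      (bitsMeasure p).map fun b (j : Finset.Iic m) => countOnes b j := by
    intro M hM
    let r (c : Finset.Iic M → ℕ) (j : Finset.Iic m) : ℕ :=
      c ⟨j, Finset.Iic_subset_Iic.mpr hM j.2⟩
    have hr : Measurable r := measurable_pi_lambda _ fun j => measurable_pi_apply _
    have h1 := congrArg (Measure.map r) (map_descend_countOnes p M)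
    rwa [Measure.map_map hr (measurable_descend_countOnes M), Measure.map_map hr (hC M)] at h1
  ext S hS
  rw [Measure.map_apply hVm hS]
  have hlim := tendsto_measure_of_ae_tendsto_indicator_of_isFiniteMeasure atTop
    (μ := jointMeasure p) (hVm hS) (fun k => hY (φ k) hS) (by
      filter_upwards [h] with ω hω
      have : ∀ᶠ k in atTop, ∀ j : Finset.Iic m,
          descend ω.2 j (φ k - j) (countOnes ω.1 (φ k)) = V j ω :=
        eventually_all.mpr fun j => hω j
      filter_upwards [this] with k hk
      simp only [Set.mem_preimage, hk])
  refine tendsto_nhds_unique hlim (tendsto_const_nhds.congr' ?_)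
  filter_upwards [eventually_ge_atTop m] with k hk
  rw [← Measure.map_apply (hY (φ k)) hS, hlaw (φ k) (hk.trans (hφ.id_le k))]

lemma ext_of_map_restrict_Iic {X : ℕ → Type*} [∀ n, MeasurableSpace (X n)]
    {μ ν : Measure (∀ n, X n)} [IsFiniteMeasure μ]
    (h : ∀ m : ℕ, μ.map (Finset.Iic m).restrict = ν.map (Finset.Iic m).restrict) : μ = ν := by
  have hI : ∀ I : Finset ℕ, ν.map I.restrict = μ.map I.restrict := by
    intro I
    have hsub := I.subset_Iic_sup_id
    rw [← Finset.restrict₂_comp_restrict hsub, ← Measure.map_map (Finset.measurable_restrict₂ _)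
      (Finset.measurable_restrict _), ← h, Measure.map_map (Finset.measurable_restrict₂ _)
      (Finset.measurable_restrict _)]
  exact IsProjectiveLimit.unique (P := fun I => μ.map I.restrict) (fun I => rfl) hI

lemma map_pascalWalk_eq (p : unitInterval)
    {V : ∀ n : ℕ, (ℕ → Bool) × (∀ n : ℕ, Fin (n + 1)) → PascalVertex n}
    (hV : ∀ n, Measurable (V n))
    (h : ∀ m : ℕ, (jointMeasure p).map (fun ω (j : Finset.Iic m) => (V j ω).val) =
      (bitsMeasure p).map fun b (j : Finset.Iic m) => countOnes b j) :
    (pascalBernoulli p).map (fun γ n => pascalWalk n γ) =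
      (jointMeasure p).map fun ω n => V n ω := by
  have hVm : Measurable fun ω n => (V n ω).val :=
    measurable_pi_lambda _ fun j => (measurable_of_countable Fin.val).comp (hV j)
  have hC : Measurable fun (b : ℕ → Bool) n => countOnes b n :=
    measurable_pi_lambda _ fun j => measurable_countOnes _
  have hW : Measurable fun (γ : PascalPath) n => pascalWalk n γ :=
    measurable_pi_lambda _ measurable_pascalWalk
  have hN : (jointMeasure p).map (fun ω n => (V n ω).val) =
      (bitsMeasure p).map fun b n => countOnes b n := by
    have : IsFiniteMeasure ((jointMeasure p).map (fun ω n => (V n ω).val)) := inferInstance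
    refine ext_of_map_restrict_Iic fun m => ?_
    rw [Measure.map_map (Finset.measurable_restrict _) hVm,
      Measure.map_map (Finset.measurable_restrict _) hC]
    exact h m
  -- Truncation at `n` returns from integers to vertices and changes no actual value of either
  -- process.
  let ψ (y : ℕ → ℕ) (n : ℕ) : PascalVertex n := ⟨min n (y n), by omega⟩
  have hψ : Measurable ψ := measurable_pi_lambda _ fun n =>
    (measurable_of_countable fun y : ℕ => (⟨min n y, by omega⟩ : PascalVertex n)).comp
      (measurable_pi_apply n)
  have e := congrArg (Measure.map ψ) hN
  rw [Measure.map_map hψ hVm, Measure.map_map hψ hC] at e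
  have e1 : (ψ ∘ fun ω n => (V n ω).val) = fun ω n => V n ω := by
    funext ω n
    exact Fin.ext (min_eq_right (Nat.lt_succ_iff.mp (V n ω).isLt))
  have e2 : (ψ ∘ fun b n => countOnes b n) =
      (fun γ n => pascalWalk n γ) ∘ pascalPathEquiv := by
    funext b n
    exact Fin.ext (min_eq_right (Nat.lt_succ_iff.mp (countOnes_lt b n)))
  rw [e1, e2, ← Measure.map_map hW pascalPathEquiv.measurable] at e
  exact e.symm

/-- The limit vertices form a copy of the walk built from the ranks alone; the bits serve only to
compare the descents and identify the law. -/
lemma exists_rank_adapted_walk (p : unitInterval) :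
    ∃ (V : ∀ n : ℕ, (ℕ → Bool) × (∀ n : ℕ, Fin (n + 1)) → PascalVertex n)
      (_ : ∀ n, Measurable (V n)),
      (∀ n, Measurable[rankFiltration (toDual n)] (V n)) ∧
      (∀ n, V n =ᵐ[jointMeasure p] fun ω => (jointRank n ω).predAbove (V (n + 1) ω)) ∧
      (pascalBernoulli p).map (fun γ n => pascalWalk n γ) =
        (jointMeasure p).map fun ω n => V n ω := by
  obtain ⟨φ, hφ, hφ'⟩ := exists_subseq_lintegral_dist_le p
  let x (k : ℕ) : ℕ := ⌊(p : ℝ) * φ k⌋₊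
  have hx : ∀ k, x k ≤ φ k := fun k =>
    Nat.floor_le_of_le (mul_le_of_le_one_left (by positivity) p.2.2)
  have hVr := measurable_limitVertex φ x
  have hV : ∀ n, Measurable (limitVertex φ x n) := fun n =>
    (hVr n).mono (rankFiltration.le _) le_rfl
  have hae : ∀ᵐ ω ∂(jointMeasure p), ∀ n,
      (∀ᶠ k in atTop, descend ω.2 n (φ k - n) (x k) = limitVertex φ x n ω) ∧
      ∀ᶠ k in atTop, descend ω.2 n (φ k - n) (countOnes ω.1 (φ k)) = limitVertex φ x n ω := by
    refine ae_all_iff.mpr fun n => ?_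
    -- The descent from `x k` is compared with random starts at levels `-φ k` and `-φ (k + 1)`; the
    -- two comparisons link consecutive indices.
    filter_upwards [ae_eventually_descend_eq p hφ (fun k => (hφ' k).1) (fun k => (hφ' k).2)
        (fun k => le_rfl) n,
      ae_eventually_descend_eq p hφ (fun k => (hφ' k).1) (fun k => (hφ' k).2)
        (M := fun k => φ (k + 1)) (fun k => (hφ k.lt_succ_self).le) n] with ω h1 h2
    exact eventually_eq_limitVertex hφ.tendsto_atTop hx
      (y := fun k => descend ω.2 n (φ k - n) (countOnes ω.1 (φ k))) h1 h2
  refine ⟨limitVertex φ x, hV, hVr, fun n => ?_, map_pascalWalk_eq p hV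
    (map_restrict_eq_of_eventually p hφ hV (hae.mono fun ω h n => (h n).2))⟩
  filter_upwards [hae] with ω h
  -- One late `k` serves levels `-n` and `-(n+1)` at once, and the recursion is the last move of
  -- that descent.
  obtain ⟨k, h1, h2, h3⟩ :=
    ((h n).1.and ((h (n + 1)).1.and (eventually_ge_atTop (n + 1)))).exists
  have h4 : n + 1 ≤ φ k := h3.trans (hφ.id_le k)
  apply Fin.ext
  rw [val_predAbove, ← h1, ← h2, show φ k - n = (φ k - (n + 1)) + 1 by omega, descend]
  rfl

end LimitVertex

/-! ### Markov property, immersion and the edge filtration -/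

section PascalFiltration

/-- The transition kernel of the random walk on the vertices, from level `-(n+1)` to level `-n`. -/
noncomputable def pascalKernel (n : ℕ) : Kernel (PascalVertex (n + 1)) (PascalVertex n) :=
  Kernel.ofFunOfCountable fun y => (rankMeasure n).map fun i => i.predAbove y

lemma pascalKernel_apply (n : ℕ) (y : PascalVertex (n + 1)) :
    pascalKernel n y = (rankMeasure n).map fun i => i.predAbove y := rfl

instance (n : ℕ) : IsMarkovKernel (pascalKernel n) :=
  ⟨fun y => by
    rw [pascalKernel_apply]
    exact Measure.isProbabilityMeasure_map (measurable_of_countable _).aemeasurable⟩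

/-- The coupling uses the same rank for both starting vertices. -/
lemma isIncreasingKernel_pascalKernel (n : ℕ) : IsIncreasingKernel (pascalKernel n) := by
  intro x x' hxx
  refine ⟨(rankMeasure n).map fun i => (i.predAbove x, i.predAbove x'), ?_, ?_, ?_⟩
  · rw [Measure.map_map measurable_fst (measurable_of_countable _)]; rfl
  · rw [Measure.map_map measurable_snd (measurable_of_countable _)]; rfl
  · rw [ae_map_iff (measurable_of_countable _).aemeasurable (Set.toFinite _).measurableSet]
    exact Filter.Eventually.of_forall fun i => Fin.predAbove_right_monotone i hxx

variable {p : unitInterval}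
  {V : ∀ n : ℕ, (ℕ → Bool) × (∀ n : ℕ, Fin (n + 1)) → PascalVertex n}

lemma condExp_rankFiltration
    (hVr : ∀ n, Measurable[rankFiltration (toDual n)] (V n))
    (hstep : ∀ n, V n =ᵐ[jointMeasure p] fun ω => (jointRank n ω).predAbove (V (n + 1) ω))
    (n : ℕ) (S : Set (PascalVertex n)) :
    (jointMeasure p)⟦V n ⁻¹' S | rankFiltration (toDual (n + 1))⟧ =ᵐ[jointMeasure p]
      fun ω => (pascalKernel n (V (n + 1) ω)).real S := by
  have h1 := condExp_preimage_of_indep (P := jointMeasure p)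
    (rankFiltration.le (toDual (n + 1))) (measurable_jointRank n)
    (indep_of_indep_of_le_right (indep_jointRank p n) (rankFiltration_le (n + 1)))
    (hVr (n + 1)) (f := fun i y => i.predAbove y) (S := S)
    (fun y => (Set.toFinite _).measurableSet)
  have h2 : (V n ⁻¹' S).indicator (fun _ => (1 : ℝ)) =ᵐ[jointMeasure p]
      ((fun ω => (jointRank n ω).predAbove (V (n + 1) ω)) ⁻¹' S).indicator fun _ => (1 : ℝ) := by
    filter_upwards [hstep n] with ω hω
    exact Set.indicator_const_eq_indicator_const (by simp only [Set.mem_preimage, hω])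
  refine (condExp_congr_ae h2).trans (h1.trans (Filter.Eventually.of_forall fun ω => ?_))
  beta_reduce
  rw [map_jointRank, pascalKernel_apply, map_measureReal_apply (measurable_of_countable _)
    S.toFinite.measurableSet]
  rfl

lemma pastFiltration_le_rankFiltration (hV : ∀ n, Measurable (V n))
    (hVr : ∀ n, Measurable[rankFiltration (toDual n)] (V n)) :
    pastFiltration V hV ≤ rankFiltration := fun k =>
  pastFiltration_le_of_measurable (n := ofDual k) _ V hV fun j hj =>
    (hVr j).mono (rankFiltration.mono (toDual_le_toDual.mpr hj)) le_rfl

/-- Given all past ranks, the conditional probability is already a function of `V (n + 1)`; the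
tower property leaves it unchanged on the smaller σ-field. -/
lemma condExp_pastFiltration (hV : ∀ n, Measurable (V n))
    (hVr : ∀ n, Measurable[rankFiltration (toDual n)] (V n))
    (hstep : ∀ n, V n =ᵐ[jointMeasure p] fun ω => (jointRank n ω).predAbove (V (n + 1) ω))
    (n : ℕ) (S : Set (PascalVertex n)) :
    (jointMeasure p)⟦V n ⁻¹' S | pastFiltration V hV (toDual (n + 1))⟧ =ᵐ[jointMeasure p]
      fun ω => (pascalKernel n (V (n + 1) ω)).real S := by
  have hK : Measurable[pastFiltration V hV (toDual (n + 1))]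
      fun ω => (pascalKernel n (V (n + 1) ω)).real S :=
    (measurable_of_countable fun y => (pascalKernel n y).real S).comp
      (measurable_pastFiltration V hV le_rfl)
  refine (condExp_condExp_of_le (pastFiltration_le_rankFiltration hV hVr _)
    (rankFiltration.le (toDual (n + 1)))).symm.trans
    ((condExp_congr_ae (condExp_rankFiltration hVr hstep n S)).trans ?_)
  rw [condExp_of_stronglyMeasurable ((pastFiltration V hV).le _) hK.stronglyMeasurable]
  refine Integrable.of_bound (hK.mono ((pastFiltration V hV).le _) le_rfl).aestronglyMeasurable 1
    (Filter.Eventually.of_forall fun ω => ?_)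
  rw [Real.norm_of_nonneg measureReal_nonneg]
  exact measureReal_le_one

lemma immersed_pastFiltration_rankFiltration (hV : ∀ n, Measurable (V n))
    (hVr : ∀ n, Measurable[rankFiltration (toDual n)] (V n))
    (hstep : ∀ n, V n =ᵐ[jointMeasure p] fun ω => (jointRank n ω).predAbove (V (n + 1) ω)) :
    Immersed (jointMeasure p) (pastFiltration V hV) rankFiltration := by
  refine ⟨pastFiltration_le_rankFiltration hV hVr, fun n => ?_⟩
  rw [pastFiltration_eq_sup V hV n]
  refine condIndep_sup_of_condExp_eq (pastFiltration_le_rankFiltration hV hVr _)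
    (hV n).comap_le (rankFiltration.le _) ?_
  rintro _ ⟨S, -, rfl⟩
  exact (condExp_rankFiltration hVr hstep n S).trans
    (condExp_pastFiltration hV hVr hstep n S).symm

lemma isProductType_rankFiltration (p : unitInterval) :
    IsProductType (jointMeasure p) rankFiltration := by
  refine ⟨fun n => Fin (n + 1), inferInstance, jointRank, measurable_jointRank, ?_, rfl⟩
  rw [iIndepFun_iff_map_fun_eq_infinitePi_map measurable_jointRank]
  simp only [map_jointRank]
  exact Measure.snd_prod

/-- With single edges, an edge is determined by its two endpoints, both of which lie in the past. -/
lemma pastFiltration_pascalEdge :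
    pastFiltration pascalEdge measurable_pascalEdge =
      pastFiltration pascalWalk measurable_pascalWalk := by
  refine Filtration.ext (funext fun k => ?_)
  apply le_antisymm
  · refine pastFiltration_le_of_measurable (n := ofDual k) _ _ _ fun j hj => ?_
    have h1 : Measurable[pastFiltration pascalWalk measurable_pascalWalk k]
        fun γ => (pascalWalk j γ, pascalWalk (j + 1) γ) :=
      (measurable_pastFiltration (n := ofDual k) pascalWalk measurable_pascalWalk hj).prodMk
        (measurable_pastFiltration (n := ofDual k) pascalWalk measurable_pascalWalk
          (Nat.le_succ_of_le hj))
    have h2 : (fun γ => (pascalEdge j γ).1) = fun γ => (pascalWalk j γ, pascalWalk (j + 1) γ) := by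
      funext γ
      exact Prod.ext rfl (γ.2 j)
    rw [← h2] at h1
    exact Measurable.subtype_mk h1
  · refine pastFiltration_le_of_measurable (n := ofDual k) _ _ _ fun j hj => ?_
    have h1 : Measurable fun e : PascalEdge j => e.1.1 := measurable_of_countable _
    exact h1.comp (measurable_pastFiltration (n := ofDual k) pascalEdge measurable_pascalEdge hj)

end PascalFiltration

instance (p : unitInterval) : IsProbabilityMeasure (pascalBernoulli p) :=
  Measure.isProbabilityMeasure_map pascalPathEquiv.measurable.aemeasurable

theorem proposition6p1 (p : unitInterval) :
    IsMonotonicMarkovProcess (pascalBernoulli p) pascalWalk measurable_pascalWalk ∧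
    IsStandardFiltration (pascalBernoulli p)
      (pastFiltration pascalWalk measurable_pascalWalk) ∧
    IsErgodicPascal (pascalBernoulli p) := by
  obtain ⟨V, hV, hVr, hstep, hmap⟩ := exists_rank_adapted_walk p
  refine ⟨⟨pascalKernel, ?_, isIncreasingKernel_pascalKernel⟩, ?_, ?_⟩
  · refine IsMarkovProcessWith.of_map_eq (P' := jointMeasure p) (hX' := hV) ?_ hmap
    exact fun n => ⟨inferInstance, fun S _ => condExp_pastFiltration hV hVr hstep n S⟩
  · exact ⟨_, inferInstance, inferInstance, jointMeasure p, inferInstance, pastFiltration V hV,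
      rankFiltration,
      ⟨PascalVertex, inferInstance, inferInstance, pascalWalk, measurable_pascalWalk, V, hV, rfl,
        rfl, hmap⟩,
      isProductType_rankFiltration p, immersed_pastFiltration_rankFiltration hV hVr hstep⟩
  · rw [IsErgodicPascal, pastFiltration_pascalEdge]
    -- Tail triviality depends only on the law, so it passes from `V` to the walk through the
    -- canonical process.
    refine IsKolmogorovian.of_canonical ?_
    rw [hmap]
    exact ((isProductType_rankFiltration p).isKolmogorovian.mono
      (pastFiltration_le_rankFiltration hV hVr)).canonical
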